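/- Let $T\ge 0$, let $A\subset\mathbb R^m$ be nonempty and compact, and let $f:[0,T]\times\mathbb R^n\times A\to\mathbb R^n$, $L:[0,T]\times\mathbb R^n\times A\to\mathbb R$, $g:\mathbb R^n\to\mathbb R$, $c:[0,T]\times\mathbb R^n\to\mathbb R$ be such that: (a) $f$ and $L$ are Lipschitz continuous in $(s,x)$ with constants independent of $a\in A$, i.e. $\|f(s_1,x_1,a)-f(s_2,x_2,a)\|\le L_f(|s_1-s_2|+\|x_1-x_2\|)$ and $|L(s_1,x_1,a)-L(s_2,x_2,a)|\le L_L(|s_1-s_2|+\|x_1-x_2\|)$, and $f(s,x,\cdot)$, $L(s,x,\cdot)$ are continuous on $A$ for each $(s,x)$; (b) $g$ is Lipschitz continuous in $x$ and $c$ is Lipschitz continuous in $(s,x)$; (c) $L$ and $g$ are bounded below. For $(t,x)\in[0,T]\times\mathbb R^n$ and $\epsilon>0$ let $$\vartheta^\epsilon(t,x)=\inf_{\alpha}\int_t^T L(s,\mathrm x(s),\alpha(s))\,ds+g(\mathrm x(T)),$$ the infimum being over all measurable $\alpha:[t,T]\to A$ and trajectories $\mathrm x$ with $\dot{\mathrm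 x}(s)=f(s,\mathrm x(s),\alpha(s))$ (for a.e. $s$, $\mathrm x$ absolutely continuous), $\mathrm x(t)=x$ and $c(s,\mathrm x(s))\le\epsilon$ for all $s\in[t,T]$; put $\inf\emptyset=+\infty$. Let $\vartheta(t,x)=\lim_{\epsilon\to0^+}\vartheta^\epsilon(t,x)$. Further let $$B(s,x)=\{-f(s,x,a):a\in A\},\quad H(s,x,p)=\max_{a\in A}\,[-p\cdot f(s,x,a)-L(s,x,a)],\quad H^*(s,x,b)=\sup_{p\in\mathbb R^n}\,[p\cdot b-H(s,x,p)],$$ and $$\bar\vartheta(t,x)=\inf_{\beta}\int_t^T H^*(s,\mathrm x(s),\beta(s))\,ds+g(\mathrm x(T)),$$ the infimum being over all integrable $\beta:[t,T]\to\mathbb R^n$ and trajectories $\mathrm x$ with $\dot{\mathrm x}(s)=-\beta(s)$ (for a.e. $s$, $\mathrm x$ absolutely continuous), $\mathrm x(t)=x$, $\beta(s)\in\mathrm{Conv}(B(s,\mathrm x(s)))$ and $c(s,\mathrm x(s))\le0$ for all $s\in[t,T]$, again with $\inf\emptyset=+\infty$. Then, for every $(t,x)\in[0,T]\times\mathbb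 R^n$, both problems are well posed (the stage cost of each is finite and integrable in $s$ along every feasible pair), the limit $\vartheta(t,x)$ exists in the extended reals, and $$\vartheta(t,x)=\bar\vartheta(t,x).$$ -/

import Mathlib

open MeasureTheory Set Filter Topology

noncomputable section

namespace StateConstrainedLax

/-- `x` solves `x' = v` on `[t, T]` with `x t = x₀`, in the sense of Carathéodory: `v` is integrable
on `[t, T]` and `x` is the (absolutely continuous) primitive of `v` starting at `x₀`. -/
def IsTrajectory {n : ℕ} (t T : ℝ) (x₀ : EuclideanSpace ℝ (Fin n))
    (x v : ℝ → EuclideanSpace ℝ (Fin n)) : Prop :=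
  IntervalIntegrable v volume t T ∧ ∀ s ∈ Icc t T, x s = x₀ + ∫ τ in t..s, v τ

/-- The admissible control signals on `[t, T]`: (Lebesgue measurable) signals with values in `A` and
finite `L^∞(t, T)` norm. -/
def IsControl {m : ℕ} (A : Set (EuclideanSpace ℝ (Fin m))) (t T : ℝ)
    (α : ℝ → EuclideanSpace ℝ (Fin m)) : Prop :=
  MemLp α ⊤ (volume.restrict (Icc t T)) ∧ ∀ s ∈ Icc t T, α s ∈ A

/-- `(x, α)` is feasible from `(t, x₀)` for the problem with state constraint `c ≤ ε`. -/
structure IsFeasible {n m : ℕ} (A : Set (EuclideanSpace ℝ (Fin m)))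
    (f : ℝ → EuclideanSpace ℝ (Fin n) → EuclideanSpace ℝ (Fin m) → EuclideanSpace ℝ (Fin n))
    (c : ℝ → EuclideanSpace ℝ (Fin n) → ℝ) (T ε t : ℝ) (x₀ : EuclideanSpace ℝ (Fin n))
    (x : ℝ → EuclideanSpace ℝ (Fin n)) (α : ℝ → EuclideanSpace ℝ (Fin m)) : Prop where
  control : IsControl A t T α
  dynamics : IsTrajectory t T x₀ x (fun s => f s (x s) (α s))
  state : ∀ s ∈ Icc t T, c s (x s) ≤ ε

/-- The value `ϑ^ε(t, x₀)` of the problem with state constraint `c ≤ ε`; it is `⊤` when no control is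
feasible. -/
def valueEps {n m : ℕ} (A : Set (EuclideanSpace ℝ (Fin m)))
    (f : ℝ → EuclideanSpace ℝ (Fin n) → EuclideanSpace ℝ (Fin m) → EuclideanSpace ℝ (Fin n))
    (L : ℝ → EuclideanSpace ℝ (Fin n) → EuclideanSpace ℝ (Fin m) → ℝ)
    (g : EuclideanSpace ℝ (Fin n) → ℝ) (c : ℝ → EuclideanSpace ℝ (Fin n) → ℝ)
    (T ε t : ℝ) (x₀ : EuclideanSpace ℝ (Fin n)) : EReal :=
  sInf {J : EReal | ∃ x α, IsFeasible A f c T ε t x₀ x α ∧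
    J = (((∫ s in t..T, L s (x s) (α s)) + g (x T) : ℝ) : EReal)}

/-- The Hamiltonian `H(s, x, p) = max_{a ∈ A} (-p · f(s, x, a) - L(s, x, a))`. -/
def hamiltonian {n m : ℕ} (A : Set (EuclideanSpace ℝ (Fin m)))
    (f : ℝ → EuclideanSpace ℝ (Fin n) → EuclideanSpace ℝ (Fin m) → EuclideanSpace ℝ (Fin n))
    (L : ℝ → EuclideanSpace ℝ (Fin n) → EuclideanSpace ℝ (Fin m) → ℝ)
    (s : ℝ) (x p : EuclideanSpace ℝ (Fin n)) : ℝ :=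
  sSup ((fun a => -(inner ℝ p (f s x a)) - L s x a) '' A)

/-- The convex conjugate `H^*(s, x, b) = sup_p (p · b - H(s, x, p))`, with values in `ℝ ∪ {±∞}`. -/
def hamiltonianConj {n m : ℕ} (A : Set (EuclideanSpace ℝ (Fin m)))
    (f : ℝ → EuclideanSpace ℝ (Fin n) → EuclideanSpace ℝ (Fin m) → EuclideanSpace ℝ (Fin n))
    (L : ℝ → EuclideanSpace ℝ (Fin n) → EuclideanSpace ℝ (Fin m) → ℝ)
    (s : ℝ) (x b : EuclideanSpace ℝ (Fin n)) : EReal :=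
  ⨆ p : EuclideanSpace ℝ (Fin n), ((inner ℝ p b - hamiltonian A f L s x p : ℝ) : EReal)

/-- The transformed control set `B(s, x) = {-f(s, x, a) | a ∈ A}`. -/
def controlSet {n m : ℕ} (A : Set (EuclideanSpace ℝ (Fin m)))
    (f : ℝ → EuclideanSpace ℝ (Fin n) → EuclideanSpace ℝ (Fin m) → EuclideanSpace ℝ (Fin n))
    (s : ℝ) (x : EuclideanSpace ℝ (Fin n)) : Set (EuclideanSpace ℝ (Fin n)) :=
  {b | ∃ a ∈ A, b = -f s x a}

/-- `(x, β)` is feasible from `(t, x₀)` for the transformed problem: `x' = -β`, `x t = x₀`,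
`β s ∈ Conv (B (s, x s))` and `c (s, x s) ≤ 0`. -/
structure IsLaxFeasible {n m : ℕ} (A : Set (EuclideanSpace ℝ (Fin m)))
    (f : ℝ → EuclideanSpace ℝ (Fin n) → EuclideanSpace ℝ (Fin m) → EuclideanSpace ℝ (Fin n))
    (c : ℝ → EuclideanSpace ℝ (Fin n) → ℝ) (T t : ℝ) (x₀ : EuclideanSpace ℝ (Fin n))
    (x β : ℝ → EuclideanSpace ℝ (Fin n)) : Prop where
  dynamics : IsTrajectory t T x₀ x (fun s => -β s)
  control : ∀ s ∈ Icc t T, β s ∈ convexHull ℝ (controlSet A f s (x s))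
  state : ∀ s ∈ Icc t T, c s (x s) ≤ 0

/-- The value of the transformed problem, with stage cost `H^*`; it is `⊤` when no pair is
feasible. -/
def laxValue {n m : ℕ} (A : Set (EuclideanSpace ℝ (Fin m)))
    (f : ℝ → EuclideanSpace ℝ (Fin n) → EuclideanSpace ℝ (Fin m) → EuclideanSpace ℝ (Fin n))
    (L : ℝ → EuclideanSpace ℝ (Fin n) → EuclideanSpace ℝ (Fin m) → ℝ)
    (g : EuclideanSpace ℝ (Fin n) → ℝ) (c : ℝ → EuclideanSpace ℝ (Fin n) → ℝ)
    (T t : ℝ) (x₀ : EuclideanSpace ℝ (Fin n)) : EReal :=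
  sInf {J : EReal | ∃ x β, IsLaxFeasible A f c T t x₀ x β ∧
    J = (((∫ s in t..T, (hamiltonianConj A f L s (x s) (β s)).toReal) + g (x T) : ℝ) : EReal)}

end StateConstrainedLax

end

/-! Velocity and stage cost are treated together as one field F = (f, L), with Γ(s, x) = Conv F(s,
x, A). These sets are compact and vary in a Lipschitz way with (s, x). Separating Γ from a vertical
ray shows that, for b in Conv B(s, x), H^*(s, x, b) is the least l with (-b, l) ∈ Γ(s, x)
(`exists_hamiltonianConj_eq`). The transformed problem is therefore the relaxed problem x' ∈ Conv
f(s, x, A), each velocity being charged its lowest convexified cost.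

For ϑ^ε ≤ ϑ̄, a selection of Γ along a feasible curve is approximated by rapidly switching ordinary
controls (`exists_control_forall_norm_integral_sub_le`). Grönwall's inequality turns small
primitives into a uniformly close trajectory (`IsLaxFeasible.exists_control`). The constraint may
then be violated slightly, which a positive ε absorbs (`valueEps_le_laxValue`).

Conversely, curves feasible for ε_k → 0, paired with their running costs, are uniformly Lipschitz
and have a limit Y. Convexity and closedness of Γ give Y' ∈ Γ almost everywhere, so the limit is
feasible for ε = 0 and its H^*-cost is no larger (`laxValue_le_of_forall_exists`). Monotonicity in ε
then yields the limit. -/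

namespace StateConstrainedLax

/-! ### Convex hulls and averages -/

section Convexity

variable {W : Type*} [NormedAddCommGroup W] [NormedSpace ℝ W]

/-- In finite dimension the convex hull of a compact set is compact. -/
theorem isCompact_convexHull_of_finiteDimensional [FiniteDimensional ℝ W] {s : Set W}
    (hs : IsCompact s) : IsCompact (convexHull ℝ s) := by
  -- Carathéodory: at most dim W + 1 points are needed, so the hull is a finite union of continuous
  -- images of compact sets. The range bound is dim W + 2 because it is exclusive.
  have key : convexHull ℝ s = ⋃ k ∈ Finset.range (Module.finrank ℝ W + 2),
      (fun p : (Fin k → ℝ) × (Fin k → W) => ∑ i, p.1 i • p.2 i) ''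
        (stdSimplex ℝ (Fin k) ×ˢ Set.pi univ fun _ => s) := by
    apply Subset.antisymm
    · intro x hx
      obtain ⟨ι, _, z, w, hz, haff, hw, hw1, hsum⟩ := eq_pos_convex_span_of_mem_convexHull hx
      have hcard : Fintype.card ι ≤ Module.finrank ℝ W + 1 := haff.card_le_finrank_succ.trans
        (Nat.add_le_add_right (Submodule.finrank_le _) 1)
      simp only [mem_iUnion]
      let e := Fintype.equivFin ι
      refine ⟨Fintype.card ι, Finset.mem_range.2 (by omega),
        (fun i => w (e.symm i), fun i => z (e.symm i)), ⟨⟨fun i => (hw _).le, ?_⟩, ?_⟩, ?_⟩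
      · rw [← hw1]; exact Equiv.sum_comp e.symm w
      · exact fun i _ => hz (mem_range_self _)
      · rw [← hsum]; exact Equiv.sum_comp e.symm fun i => w i • z i
    · simp only [iUnion_subset_iff]
      rintro k - _ ⟨⟨w, z⟩, ⟨⟨hw, hw1⟩, hz⟩, rfl⟩
      exact (convex_convexHull ℝ s).sum_mem (fun i _ => hw i) hw1
        fun i _ => subset_convexHull ℝ s (hz i (mem_univ _))
  rw [key]
  refine (Finset.range _).isCompact_biUnion fun k _ => IsCompact.image ?_ (by fun_prop)
  exact (isCompact_stdSimplex ℝ (Fin k)).prod (isCompact_univ_pi fun _ => hs)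

/-- The distance to a convex set of an average is at most the supremum of the distances. -/
theorem infDist_average_le [CompleteSpace W] {C : Set W} (hC : Convex ℝ C) (hne : C.Nonempty)
    {a b r : ℝ} (hab : a < b) {w : ℝ → W} (hw : IntervalIntegrable w volume a b)
    (h : ∀ τ ∈ Icc a b, Metric.infDist (w τ) C ≤ r) :
    Metric.infDist ((b - a)⁻¹ • ∫ τ in a..b, w τ) C ≤ r := by
  have hr : 0 ≤ r := Metric.infDist_nonneg.trans (h a ⟨le_rfl, hab.le⟩)
  -- The sublevel set of the distance is a closed thickening, which is convex and closed and hence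
  -- stable under averages.
  have hmem : ∀ y, y ∈ Metric.cthickening r C ↔ Metric.infDist y C ≤ r := fun y => by
    rw [Metric.mem_cthickening_iff, Metric.infDist,
      ENNReal.le_ofReal_iff_toReal_le (Metric.infEDist_ne_top hne) hr]
  rw [← hmem, ← interval_average_eq, uIoc_of_le hab.le]
  refine (hC.cthickening r).set_average_mem Metric.isClosed_cthickening ?_ ?_ ?_
    ((intervalIntegrable_iff_integrableOn_Ioc_of_le hab.le).1 hw)
  · simp [hab]
  · simp
  · exact (ae_restrict_mem measurableSet_Ioc).mono fun τ hτ => (hmem _).2 (h τ (Ioc_subset_Icc_self hτ))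

/-- A point of the convex hull of `G '' A` is the average over `[a, b]` of `G` along a
piecewise constant control. -/
theorem exists_control_integral_eq [CompleteSpace W] {U : Type*} [MeasurableSpace U] {A : Set U}
    {G : U → W} {w : W} (hw : w ∈ convexHull ℝ (G '' A)) :
    ∀ a b : ℝ, a ≤ b → ∃ α : ℝ → U, Measurable α ∧ (∀ s, α s ∈ A) ∧
      (∀ c d, IntervalIntegrable (fun s => G (α s)) volume c d) ∧
      ∫ s in a..b, G (α s) = (b - a) • w := by
  -- Quantifying over all intervals makes S convex: a combination with weights p, q is realised by
  -- splitting [a, b] in the ratio p : q.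
  let S : Set W := {w | ∀ a b : ℝ, a ≤ b → ∃ α : ℝ → U, Measurable α ∧ (∀ s, α s ∈ A) ∧
      (∀ c d, IntervalIntegrable (fun s => G (α s)) volume c d) ∧
      ∫ s in a..b, G (α s) = (b - a) • w}
  suffices h : convexHull ℝ (G '' A) ⊆ S from h hw
  refine convexHull_min ?_ ?_
  · rintro _ ⟨u, hu, rfl⟩ a b -
    exact ⟨fun _ => u, measurable_const, fun _ => hu, fun _ _ => intervalIntegrable_const, by simp⟩
  · intro w₁ h₁ w₂ h₂ p q hp hq hpq a b hab
    set e := a + p * (b - a) with he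
    have hae : a ≤ e := by nlinarith
    have heb : e ≤ b := by nlinarith
    obtain ⟨α₁, hm₁, hA₁, hi₁, hv₁⟩ := h₁ a e hae
    obtain ⟨α₂, hm₂, hA₂, hi₂, hv₂⟩ := h₂ e b heb
    have hG : (fun s => G ((Iic e).piecewise α₁ α₂ s)) =
        (Iic e).piecewise (fun s => G (α₁ s)) fun s => G (α₂ s) := by
      ext s; by_cases hs : s ∈ Iic e <;> simp [Set.piecewise, hs]
    have hint : ∀ c d, IntervalIntegrable (fun s => G ((Iic e).piecewise α₁ α₂ s)) volume c d := by
      intro c d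
      rw [hG, intervalIntegrable_iff]
      have g₁ := (intervalIntegrable_iff.1 (hi₁ c d))
      have g₂ := (intervalIntegrable_iff.1 (hi₂ c d))
      exact Integrable.piecewise measurableSet_Iic (Integrable.integrableOn g₁) (Integrable.integrableOn g₂)
    refine ⟨(Iic e).piecewise α₁ α₂, hm₁.piecewise measurableSet_Iic hm₂, fun s => ?_, hint, ?_⟩
    · by_cases hs : s ∈ Iic e <;> simp [Set.piecewise, hs, hA₁, hA₂]
    · rw [← intervalIntegral.integral_add_adjacent_intervals (hint a e) (hint e b)]
      have i₁ : ∫ s in a..e, G ((Iic e).piecewise α₁ α₂ s) = ∫ s in a..e, G (α₁ s) := by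
        refine intervalIntegral.integral_congr_ae (ae_of_all _ fun s hs => ?_)
        rw [uIoc_of_le hae] at hs
        rw [piecewise_eq_of_mem _ _ _ (show s ∈ Iic e from hs.2)]
      have i₂ : ∫ s in e..b, G ((Iic e).piecewise α₁ α₂ s) = ∫ s in e..b, G (α₂ s) := by
        refine intervalIntegral.integral_congr_ae (ae_of_all _ fun s hs => ?_)
        rw [uIoc_of_le heb] at hs
        rw [piecewise_eq_of_notMem _ _ _ (show s ∉ Iic e from not_le.2 hs.1)]
      rw [i₁, i₂, hv₁, hv₂, smul_add, smul_smul, smul_smul]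
      congr 2
      · rw [he]; ring
      · rw [he]; linear_combination (-(b - a)) * hpq

end Convexity

/-! ### Fundamental theorem of calculus for Lipschitz curves -/

section Lipschitz

variable {W : Type*} [NormedAddCommGroup W] [NormedSpace ℝ W] [FiniteDimensional ℝ W]

/-- The derivative of a Lipschitz curve is interval integrable. -/
theorem intervalIntegrable_deriv_of_lipschitz {X : ℝ → W} {M : NNReal} (hX : LipschitzWith M X)
    (a b : ℝ) : IntervalIntegrable (deriv X) volume a b := by
  have := FiniteDimensional.complete ℝ W
  refine (intervalIntegrable_const (c := (M : ℝ))).mono_fun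
    (stronglyMeasurable_deriv X).aestronglyMeasurable
    (ae_of_all _ fun s => ?_)
  simpa using norm_deriv_le_of_lipschitz hX

theorem integral_deriv_eq_sub_of_lipschitz {X : ℝ → W} {M : NNReal} (hX : LipschitzWith M X)
    (a b : ℝ) : ∫ s in a..b, deriv X s = X b - X a := by
  have := FiniteDimensional.complete ℝ W
  have hi := intervalIntegrable_deriv_of_lipschitz hX
  -- The defect g is Lipschitz, hence absolutely continuous, and has zero derivative almost
  -- everywhere, so it is constant.
  let g : ℝ → W := fun x => X x - ∫ s in a..x, deriv X s
  have hg : LipschitzWith (M + M) g := by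
    refine hX.sub (LipschitzWith.of_dist_le_mul fun x y => ?_)
    rw [dist_eq_norm, intervalIntegral.integral_interval_sub_left (hi _ _) (hi _ _)]
    have := intervalIntegral.norm_integral_le_of_norm_le_const (a := y) (b := x) (C := M)
      (f := deriv X) fun s _ => norm_deriv_le_of_lipschitz hX
    rwa [Real.dist_eq]
  have h0 : ∀ᵐ x, x ∈ uIcc a b → HasDerivAt g 0 x := by
    filter_upwards [hX.ae_differentiableAt (μ := volume), (hi a b).ae_hasDerivAt_integral]
      with x h₁ h₂ hx
    have := h₁.hasDerivAt.sub (h₂ hx a (by simp))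
    rwa [sub_self] at this
  obtain ⟨C, hC⟩ := ((hg.lipschitzOnWith (s := uIcc a b)).absolutelyContinuousOnInterval).const_of_ae_hasDerivAt_zero h0
  have ha := hC a (by simp)
  have hb := hC b (by simp)
  simp only [g, intervalIntegral.integral_same, sub_zero] at ha hb
  rw [ha, ← hb]; abel

end Lipschitz

/-! ### Grönwall's inequality -/

section Gronwall

theorem integral_exp_mul_sub {l t s : ℝ} (hl : 0 < l) :
    ∫ τ in t..s, Real.exp (l * (τ - t)) = (Real.exp (l * (s - t)) - 1) / l := by
  have : ∀ x ∈ uIcc t s, HasDerivAt (fun τ => Real.exp (l * (τ - t)) / l)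
      (Real.exp (l * (x - t))) x := fun x _ => by
    have h := ((((hasDerivAt_id x).sub_const t).const_mul l).exp).div_const l
    simp only [id, mul_one] at h
    rwa [mul_div_cancel_right₀ _ hl.ne'] at h
  rw [intervalIntegral.integral_eq_sub_of_hasDerivAt this
    (by apply Continuous.intervalIntegrable; fun_prop)]
  simp; ring

/-- Grönwall's inequality in integral form. -/
theorem le_of_le_add_mul_integral {u : ℝ → ℝ} {t T K δ : ℝ} (hK : 0 < K) (hδ : 0 ≤ δ)
    (hu : ContinuousOn u (Icc t T))
    (h : ∀ s ∈ Icc t T, u s ≤ δ + K * ∫ τ in t..s, u τ) :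
    ∀ s ∈ Icc t T, u s ≤ 2 * δ * Real.exp (2 * K * (T - t)) := by
  intro s₀ hs₀
  -- With the weight exp(-2K(s - t)), evaluating the hypothesis at the maximum point lets half of
  -- the exponential term absorb the integral. No sign of u is needed, since a nonpositive maximum
  -- is harmless.
  obtain ⟨s₁, hs₁, hmax⟩ := isCompact_Icc.exists_isMaxOn ⟨s₀, hs₀⟩
    (f := fun s => Real.exp (-(2 * K * (s - t))) * u s) (by fun_prop)
  set m := Real.exp (-(2 * K * (s₁ - t))) * u s₁ with hm
  have hle : ∀ s ∈ Icc t T, u s ≤ m * Real.exp (2 * K * (s - t)) := fun s hs => by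
    have h1 : Real.exp (-(2 * K * (s - t))) * u s ≤ m := hmax hs
    have h2 := mul_le_mul_of_nonneg_right h1 (Real.exp_pos (2 * K * (s - t))).le
    rw [Real.exp_neg] at h2
    have h3 := Real.exp_pos (2 * K * (s - t))
    field_simp at h2
    linarith
  have hint : ∫ τ in t..s₁, u τ ≤ ∫ τ in t..s₁, m * Real.exp (2 * K * (τ - t)) := by
    refine intervalIntegral.integral_mono_on hs₁.1 ?_ (by apply Continuous.intervalIntegrable; fun_prop)
      fun τ hτ => hle τ ⟨hτ.1, hτ.2.trans hs₁.2⟩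
    apply ContinuousOn.intervalIntegrable
    rw [uIcc_of_le hs₁.1]
    exact hu.mono (Icc_subset_Icc_right hs₁.2)
  rw [intervalIntegral.integral_const_mul, integral_exp_mul_sub (by positivity)] at hint
  have hu₁ : u s₁ = m * Real.exp (2 * K * (s₁ - t)) := by
    rw [hm, Real.exp_neg]; field_simp
  have h1 := h s₁ hs₁
  have he1 : 1 ≤ Real.exp (2 * K * (s₁ - t)) := Real.one_le_exp (by nlinarith [hs₁.1])
  have hm2 : m ≤ 2 * δ := by
    rcases le_or_gt m 0 with hm0 | hm0
    · linarith
    have h2 : K * ∫ τ in t..s₁, u τ ≤ m * (Real.exp (2 * K * (s₁ - t)) - 1) / 2 := by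
      calc _ ≤ K * (m * ((Real.exp (2 * K * (s₁ - t)) - 1) / (2 * K))) := by gcongr
        _ = _ := by field_simp
    rw [hu₁] at h1
    set e := Real.exp (2 * K * (s₁ - t))
    by_contra! hcon
    nlinarith
  calc u s₀ ≤ m * Real.exp (2 * K * (s₀ - t)) := hle s₀ hs₀
    _ ≤ 2 * δ * Real.exp (2 * K * (s₀ - t)) := by gcongr
    _ ≤ _ := by
      gcongr
      exact hs₀.2

end Gronwall

/-! ### Global solutions of Carathéodory equations -/

section Picard

variable {E : Type*} [NormedAddCommGroup E] [NormedSpace ℝ E] [CompleteSpace E]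

/-- Global existence for Carathéodory equations whose right-hand side is globally Lipschitz
in the state. -/
theorem exists_eq_add_integral {t T K : ℝ} (htT : t ≤ T) (hK : 0 < K) (x₀ : E) (v : ℝ → E → E)
    (hint : ∀ y : ℝ → E, Continuous y → IntervalIntegrable (fun τ => v τ (y τ)) volume t T)
    (hv : ∀ τ ∈ Icc t T, ∀ y z, ‖v τ y - v τ z‖ ≤ K * ‖y - z‖) :
    ∃ y : ℝ → E, Continuous y ∧ ∀ s ∈ Icc t T, y s = x₀ + ∫ τ in t..s, v τ (y τ) := by
  -- The unknown is u(s) = exp(-2K(s - t)) y(s), so the sup norm of u is a weighted norm of y. The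
  -- Picard map then contracts by 1/2 whatever the length of the interval.
  let ext : C(Icc t T, E) → ℝ → E := fun u τ => Real.exp (2 * K * (τ - t)) • u (projIcc t T htT τ)
  have hext : ∀ u, Continuous (ext u) := fun u =>
    (by fun_prop : Continuous fun τ => Real.exp (2 * K * (τ - t))).smul
      (u.continuous.comp continuous_projIcc)
  have hprim : ∀ u, ContinuousOn (fun s => x₀ + ∫ τ in t..s, v τ (ext u τ)) (Icc t T) := fun u => by
    have hi := (intervalIntegrable_iff_integrableOn_Icc_of_le htT).1 (hint _ (hext u))
    rw [← uIcc_of_le htT] at hi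
    have := intervalIntegral.continuousOn_primitive_interval hi
    rw [uIcc_of_le htT] at this
    exact continuousOn_const.add this
  let P : C(Icc t T, E) → C(Icc t T, E) := fun u =>
    ⟨fun s => Real.exp (-(2 * K * (s - t))) • (x₀ + ∫ τ in t..(s : ℝ), v τ (ext u τ)),
      (by fun_prop : Continuous fun s : Icc t T => Real.exp (-(2 * K * ((s : ℝ) - t)))).smul
        (continuousOn_iff_continuous_domRestrict.1 (hprim u))⟩
  have hP : ContractingWith (1 / 2) P := by
    refine ⟨by rw [← NNReal.coe_lt_coe]; norm_num, LipschitzWith.of_dist_le_mul fun u w => ?_⟩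
    rw [ContinuousMap.dist_le (by positivity)]
    rintro ⟨s, hs⟩
    have hsub : uIcc t s ⊆ uIcc t T := by
      rw [uIcc_of_le htT, uIcc_of_le hs.1]; exact Icc_subset_Icc_right hs.2
    have hiu := (hint _ (hext u)).mono_set hsub
    have hiw := (hint _ (hext w)).mono_set hsub
    have hb : ‖∫ τ in t..s, (v τ (ext u τ) - v τ (ext w τ))‖ ≤
        ∫ τ in t..s, K * dist u w * Real.exp (2 * K * (τ - t)) := by
      refine intervalIntegral.norm_integral_le_of_norm_le hs.1 (ae_of_all _ fun τ hτ => ?_)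
        (by apply Continuous.intervalIntegrable; fun_prop)
      have := hv τ ⟨hτ.1.le, hτ.2.trans hs.2⟩ (ext u τ) (ext w τ)
      refine this.trans ?_
      simp only [ext]
      rw [← smul_sub, norm_smul, Real.norm_of_nonneg (Real.exp_pos _).le, ← dist_eq_norm]
      have hd : dist (u (projIcc t T htT τ)) (w (projIcc t T htT τ)) ≤ dist u w :=
        ContinuousMap.dist_apply_le_dist _
      calc _ ≤ K * (Real.exp (2 * K * (τ - t)) * dist u w) := by gcongr
        _ = _ := by ring
    rw [intervalIntegral.integral_const_mul, integral_exp_mul_sub (by positivity)] at hb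
    simp only [P, ContinuousMap.coe_mk, dist_eq_norm]
    rw [← smul_sub, norm_smul, Real.norm_of_nonneg (Real.exp_pos _).le, add_sub_add_left_eq_sub,
      ← intervalIntegral.integral_sub hiu hiw]
    calc _ ≤ Real.exp (-(2 * K * (s - t))) *
          (K * dist u w * ((Real.exp (2 * K * (s - t)) - 1) / (2 * K))) := by gcongr
      _ = (1 - Real.exp (-(2 * K * (s - t)))) * (1 / 2) * dist u w := by
        rw [Real.exp_neg]; field_simp
      _ ≤ 1 * (1 / 2) * dist u w := by
        gcongr; linarith [Real.exp_pos (-(2 * K * (s - t)))]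
      _ = _ := by rw [← dist_eq_norm]; simp
  have : Nonempty C(Icc t T, E) := ⟨0⟩
  obtain ⟨u, hu⟩ : ∃ u, P u = u := ⟨_, hP.fixedPoint_isFixedPt⟩
  refine ⟨ext u, hext u, fun s hs => ?_⟩
  have h1 : u ⟨s, hs⟩ = Real.exp (-(2 * K * (s - t))) • (x₀ + ∫ τ in t..s, v τ (ext u τ)) := by
    conv_lhs => rw [← hu]
    rfl
  have h2 : ext u s = Real.exp (2 * K * (s - t)) • u ⟨s, hs⟩ := by
    simp only [ext, projIcc_of_mem htT hs]
  rw [h2, h1, smul_smul, ← Real.exp_add]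
  simp

end Picard

/-! ### Lipschitz fields with a control parameter -/

section Field

variable {E U W : Type*} [NormedAddCommGroup E] [NormedAddCommGroup U] [NormedAddCommGroup W]

/-- `F` is continuous in the control and `K`-Lipschitz in time and state, uniformly in the control. -/
structure IsLipField (A : Set U) (T K : ℝ) (F : ℝ → E → U → W) : Prop where
  cont : ∀ s ∈ Icc 0 T, ∀ x, ContinuousOn (fun a => F s x a) A
  lip : ∀ a ∈ A, ∀ s₁ ∈ Icc 0 T, ∀ s₂ ∈ Icc 0 T, ∀ x₁ x₂,
    ‖F s₁ x₁ a - F s₂ x₂ a‖ ≤ K * (|s₁ - s₂| + ‖x₁ - x₂‖)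

variable {A : Set U} {T K : ℝ} {F : ℝ → E → U → W}

theorem IsLipField.continuousOn (hF : IsLipField A T K F) :
    ContinuousOn (fun p : ℝ × E × U => F p.1 p.2.1 p.2.2) (Icc 0 T ×ˢ univ ×ˢ A) := by
  rintro ⟨s₀, x₀, a₀⟩ ⟨hs₀, -, ha₀⟩
  rw [ContinuousWithinAt, tendsto_iff_norm_sub_tendsto_zero]
  have h1 : Tendsto (fun p : ℝ × E × U => K * (|p.1 - s₀| + ‖p.2.1 - x₀‖))
      (𝓝[Icc 0 T ×ˢ univ ×ˢ A] (s₀, x₀, a₀)) (𝓝 0) := by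
    have : Continuous fun p : ℝ × E × U => K * (|p.1 - s₀| + ‖p.2.1 - x₀‖) := by fun_prop
    simpa using (this.tendsto (s₀, x₀, a₀)).mono_left nhdsWithin_le_nhds
  have h2 : Tendsto (fun p : ℝ × E × U => ‖F s₀ x₀ p.2.2 - F s₀ x₀ a₀‖)
      (𝓝[Icc 0 T ×ˢ univ ×ˢ A] (s₀, x₀, a₀)) (𝓝 0) := by
    rw [← tendsto_iff_norm_sub_tendsto_zero]
    refine Tendsto.comp (hF.cont s₀ hs₀ x₀ a₀ ha₀) (tendsto_nhdsWithin_iff.2 ⟨?_, ?_⟩)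
    · exact (continuous_snd.snd.tendsto (s₀, x₀, a₀)).mono_left nhdsWithin_le_nhds
    · exact eventually_nhdsWithin_of_forall fun p hp => hp.2.2
  have h3 := h1.add h2
  rw [add_zero] at h3
  refine squeeze_zero' (Eventually.of_forall fun _ => norm_nonneg _) ?_ h3
  refine eventually_nhdsWithin_of_forall fun p hp => ?_
  refine (norm_sub_le_norm_sub_add_norm_sub _ (F s₀ x₀ p.2.2) _).trans ?_
  gcongr
  exact hF.lip _ hp.2.2 _ hp.1 _ hs₀ _ _

theorem IsLipField.exists_bound (hF : IsLipField A T K F) (hA : IsCompact A) (hT : 0 ≤ T)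
    (hK : 0 < K) : ∃ M, 0 ≤ M ∧ ∀ s ∈ Icc 0 T, ∀ x, ∀ a ∈ A, ‖F s x a‖ ≤ M + K * ‖x‖ := by
  obtain ⟨C, hC⟩ := hA.exists_bound_of_continuousOn (hF.cont 0 ⟨le_rfl, hT⟩ 0)
  refine ⟨|C| + K * T, by positivity, fun s hs x a ha => ?_⟩
  have h1 := hF.lip a ha s hs 0 ⟨le_rfl, hT⟩ x 0
  have h2 := hC a ha
  have h3 := norm_le_norm_add_norm_sub' (F s x a) (F 0 0 a)
  rw [sub_zero, sub_zero, abs_of_nonneg hs.1] at h1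
  have h4 : K * s ≤ K * T := by gcongr; exact hs.2
  linarith [le_abs_self C]

/-- The field along a curve and a control is integrable. -/
theorem IsLipField.integrableOn [MeasurableSpace E] [BorelSpace E] [SecondCountableTopology E]
    [MeasurableSpace U] [BorelSpace U] [SecondCountableTopology U]
    [MeasurableSpace W] [BorelSpace W] [SecondCountableTopology W]
    (hF : IsLipField A T K F) (hA : IsCompact A) (hK : 0 < K) {t : ℝ}
    (ht : t ∈ Icc 0 T) {x : ℝ → E} (hx : ContinuousOn x (Icc t T)) {α : ℝ → U}
    (hα : AEMeasurable α (volume.restrict (Icc t T))) (hαA : ∀ s ∈ Icc t T, α s ∈ A) :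
    IntegrableOn (fun s => F s (x s) (α s)) (Icc t T) := by
  classical
  have hsub : Icc t T ⊆ Icc 0 T := Icc_subset_Icc_left ht.1
  set S : Set (ℝ × E × U) := Icc 0 T ×ˢ univ ×ˢ A
  have hS : MeasurableSet S :=
    measurableSet_Icc.prod (MeasurableSet.univ.prod hA.measurableSet)
  -- F is controlled only on S; extending it by zero gives a globally Borel map to compose with (s,
  -- x s, α s).
  have hm : Measurable (S.piecewise (fun p : ℝ × E × U => F p.1 p.2.1 p.2.2) fun _ => 0) :=
    hF.continuousOn.measurable_piecewise continuousOn_const hS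
  have hmeas : AEMeasurable (fun s => F s (x s) (α s)) (volume.restrict (Icc t T)) := by
    refine (hm.comp_aemeasurable (f := fun s => (s, x s, α s)) (μ := volume.restrict (Icc t T))
      (aemeasurable_id.prodMk ((hx.aemeasurable measurableSet_Icc).prodMk hα))).congr ?_
    filter_upwards [ae_restrict_mem measurableSet_Icc] with s hs
    exact piecewise_eq_of_mem S (fun p : ℝ × E × U => F p.1 p.2.1 p.2.2) (fun _ => (0 : W))
      (show (s, x s, α s) ∈ S from ⟨hsub hs, mem_univ _, hαA s hs⟩)
  obtain ⟨M, hM, hb⟩ := hF.exists_bound hA (ht.1.trans ht.2) hK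
  obtain ⟨R, hR⟩ := isCompact_Icc.exists_bound_of_continuousOn hx
  refine Integrable.of_bound hmeas.aestronglyMeasurable (M + K * R) ?_
  filter_upwards [ae_restrict_mem measurableSet_Icc] with s hs
  refine (hb s (hsub hs) (x s) (α s) (hαA s hs)).trans ?_
  gcongr
  exact hR s hs

theorem IsLipField.isCompact_hull [NormedSpace ℝ W] [FiniteDimensional ℝ W]
    (hF : IsLipField A T K F) (hA : IsCompact A) {s : ℝ} (hs : s ∈ Icc 0 T) (x : E) :
    IsCompact (convexHull ℝ (F s x '' A)) :=
  isCompact_convexHull_of_finiteDimensional (hA.image_of_continuousOn (hF.cont s hs x))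

/-- Each generator F(s, x, a) is close to F(s', x', a) with the same a, and a closed thickening of a
convex set is convex, so the estimate passes to the whole hull. -/
theorem IsLipField.infDist_hull_le [NormedSpace ℝ W] (hF : IsLipField A T K F) (hA : A.Nonempty)
    (hK : 0 < K) {s s' : ℝ} (hs : s ∈ Icc 0 T) (hs' : s' ∈ Icc 0 T) (x x' : E) {w : W}
    (hw : w ∈ convexHull ℝ (F s x '' A)) :
    Metric.infDist w (convexHull ℝ (F s' x' '' A)) ≤ K * (|s - s'| + ‖x - x'‖) := by
  set r := K * (|s - s'| + ‖x - x'‖)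
  have hr : 0 ≤ r := by positivity
  have hne : (convexHull ℝ (F s' x' '' A)).Nonempty := (hA.image _).convexHull
  suffices h : convexHull ℝ (F s x '' A) ⊆ Metric.cthickening r (convexHull ℝ (F s' x' '' A)) by
    have := h hw
    rwa [Metric.mem_cthickening_iff, ENNReal.le_ofReal_iff_toReal_le (Metric.infEDist_ne_top hne) hr]
      at this
  refine convexHull_min ?_ ((convex_convexHull ℝ _).cthickening r)
  rintro _ ⟨a, ha, rfl⟩
  refine Metric.mem_cthickening_of_dist_le _ (F s' x' a) _ _
    (subset_convexHull ℝ _ (mem_image_of_mem _ ha)) ?_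
  rw [dist_eq_norm]
  exact hF.lip a ha s hs s' hs' x x'

end Field

/-! ### The conjugate Hamiltonian as the lower boundary of the hull -/

section Hamiltonian

variable {n m : ℕ} {A : Set (EuclideanSpace ℝ (Fin m))}
  {f : ℝ → EuclideanSpace ℝ (Fin n) → EuclideanSpace ℝ (Fin m) → EuclideanSpace ℝ (Fin n)}
  {L : ℝ → EuclideanSpace ℝ (Fin n) → EuclideanSpace ℝ (Fin m) → ℝ} {T K : ℝ}

/-- The velocity and the stage cost, as one vector field. -/
def augField {n m : ℕ}
    (f : ℝ → EuclideanSpace ℝ (Fin n) → EuclideanSpace ℝ (Fin m) → EuclideanSpace ℝ (Fin n))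
    (L : ℝ → EuclideanSpace ℝ (Fin n) → EuclideanSpace ℝ (Fin m) → ℝ)
    (s : ℝ) (x : EuclideanSpace ℝ (Fin n)) (a : EuclideanSpace ℝ (Fin m)) :
    EuclideanSpace ℝ (Fin n) × ℝ := (f s x a, L s x a)

theorem IsLipField.fst (hF : IsLipField A T K (augField f L)) : IsLipField A T K f where
  cont s hs x := (hF.cont s hs x).fst
  lip a ha s₁ h₁ s₂ h₂ x₁ x₂ := (norm_fst_le _).trans (hF.lip a ha s₁ h₁ s₂ h₂ x₁ x₂)

theorem IsLipField.snd (hF : IsLipField A T K (augField f L)) : IsLipField A T K L where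
  cont s hs x := (hF.cont s hs x).snd
  lip a ha s₁ h₁ s₂ h₂ x₁ x₂ := (norm_snd_le _).trans (hF.lip a ha s₁ h₁ s₂ h₂ x₁ x₂)

theorem mem_convexHull_controlSet {s : ℝ} {x b : EuclideanSpace ℝ (Fin n)} :
    b ∈ convexHull ℝ (controlSet A f s x) ↔ -b ∈ convexHull ℝ (f s x '' A) := by
  have : controlSet A f s x = -(f s x '' A) := by
    ext b
    simp only [controlSet, mem_ofPred_eq, Set.mem_neg, mem_image]
    exact exists_congr fun a => and_congr_right fun _ => by
      rw [eq_comm, neg_eq_iff_eq_neg]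
  rw [this, convexHull_neg, Set.mem_neg]

theorem fst_mem_of_mem_hull {s : ℝ} {x : EuclideanSpace ℝ (Fin n)}
    {w : EuclideanSpace ℝ (Fin n) × ℝ} (hw : w ∈ convexHull ℝ (augField f L s x '' A)) :
    w.1 ∈ convexHull ℝ (f s x '' A) := by
  have h := mem_image_of_mem (LinearMap.fst ℝ (EuclideanSpace ℝ (Fin n)) ℝ) hw
  rw [LinearMap.image_convexHull, image_image] at h
  exact h

theorem exists_mem_hull {s : ℝ} {x v : EuclideanSpace ℝ (Fin n)}
    (hv : v ∈ convexHull ℝ (f s x '' A)) : ∃ l, (v, l) ∈ convexHull ℝ (augField f L s x '' A) := by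
  have h : (LinearMap.fst ℝ (EuclideanSpace ℝ (Fin n)) ℝ) '' convexHull ℝ (augField f L s x '' A) =
      convexHull ℝ (f s x '' A) := by
    rw [LinearMap.image_convexHull, image_image]; rfl
  rw [← h] at hv
  obtain ⟨⟨v', l⟩, hw, rfl⟩ := hv
  exact ⟨l, hw⟩

theorem bddAbove_hamiltonian (hF : IsLipField A T K (augField f L)) (hA : IsCompact A) {s : ℝ}
    (hs : s ∈ Icc 0 T) (x p : EuclideanSpace ℝ (Fin n)) :
    BddAbove ((fun a => -(inner ℝ p (f s x a)) - L s x a) '' A) := by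
  have h1 := hF.fst.cont s hs x
  have h2 := hF.snd.cont s hs x
  exact (hA.image_of_continuousOn (((continuousOn_const.inner h1).neg).sub h2)).bddAbove

theorem le_hamiltonian (hF : IsLipField A T K (augField f L)) (hA : IsCompact A) {s : ℝ}
    (hs : s ∈ Icc 0 T) (x p : EuclideanSpace ℝ (Fin n)) {a : EuclideanSpace ℝ (Fin m)}
    (ha : a ∈ A) : -(inner ℝ p (f s x a)) - L s x a ≤ hamiltonian A f L s x p :=
  le_csSup (bddAbove_hamiltonian hF hA hs x p) (mem_image_of_mem _ ha)

/-- For each p, the half-space ⟨p, v⟩ + l ≥ -H(s, x, p) contains every (f, L) value, hence the hull.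
-/
theorem hamiltonianConj_le_of_mem_hull (hF : IsLipField A T K (augField f L)) (hA : IsCompact A)
    {s : ℝ} (hs : s ∈ Icc 0 T) {x v : EuclideanSpace ℝ (Fin n)} {l : ℝ}
    (hw : (v, l) ∈ convexHull ℝ (augField f L s x '' A)) :
    hamiltonianConj A f L s x (-v) ≤ l := by
  refine iSup_le fun p => EReal.coe_le_coe_iff.2 ?_
  let φ : EuclideanSpace ℝ (Fin n) × ℝ → ℝ := fun w => inner ℝ p w.1 + w.2
  have hφ : IsLinearMap ℝ φ := by
    refine ⟨fun y z => ?_, fun c y => ?_⟩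
    · simp only [φ, Prod.fst_add, Prod.snd_add, inner_add_right]; ring
    · simp only [φ, Prod.smul_fst, Prod.smul_snd, inner_smul_right, smul_eq_mul]; ring
  have hsub : convexHull ℝ (augField f L s x '' A) ⊆ {w | -hamiltonian A f L s x p ≤ φ w} := by
    refine convexHull_min ?_ (convex_halfSpace_ge hφ _)
    rintro _ ⟨a, ha, rfl⟩
    have := le_hamiltonian hF hA hs x p ha
    simp only [φ, augField, mem_ofPred_eq]
    linarith
  have := hsub hw
  simp only [φ, mem_ofPred_eq] at this
  rw [inner_neg_right]
  linarith

theorem hamiltonianConj_ne_bot (s : ℝ) (x b : EuclideanSpace ℝ (Fin n)) :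
    hamiltonianConj A f L s x b ≠ ⊥ := by
  refine ne_of_gt (lt_of_lt_of_le (EReal.bot_lt_coe _) (le_iSup (fun p : EuclideanSpace ℝ (Fin n) =>
    ((inner ℝ p b - hamiltonian A f L s x p : ℝ) : EReal)) 0))

/-- On the convexified control set the conjugate `H^*` is finite, and it is attained by a convex
combination of velocities and costs. -/
theorem exists_hamiltonianConj_eq (hF : IsLipField A T K (augField f L)) (hA : IsCompact A)
    (hA_ne : A.Nonempty)
    {s : ℝ} (hs : s ∈ Icc 0 T) {x b : EuclideanSpace ℝ (Fin n)}
    (hb : b ∈ convexHull ℝ (controlSet A f s x)) :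
    ∃ h : ℝ, hamiltonianConj A f L s x b = h ∧
      (-b, h) ∈ convexHull ℝ (augField f L s x '' A) := by
  set Γ := convexHull ℝ (augField f L s x '' A) with hΓ
  obtain ⟨l₀, hl₀⟩ := exists_mem_hull (L := L) (mem_convexHull_controlSet.1 hb)
  have hle : ∀ l, (-b, l) ∈ Γ → hamiltonianConj A f L s x b ≤ l := fun l hl => by
    simpa using hamiltonianConj_le_of_mem_hull hF hA hs hl
  obtain ⟨h, hh⟩ : ∃ h : ℝ, hamiltonianConj A f L s x b = h :=
    ⟨_, (EReal.coe_toReal (ne_of_lt ((hle l₀ hl₀).trans_lt (EReal.coe_lt_top _)))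
      (hamiltonianConj_ne_bot s x b)).symm⟩
  refine ⟨h, hh, ?_⟩
  -- Any hull point above -b has height at least h, so one of height at most h has height exactly h.
  suffices hex : ∃ l ≤ h, (-b, l) ∈ Γ by
    obtain ⟨l, hlh, hl⟩ := hex
    have := hle l hl
    rw [hh, EReal.coe_le_coe_iff] at this
    rwa [le_antisymm this hlh]
  by_contra! hcon
  -- Otherwise the compact hull is strictly separated from the downward ray below (-b, h), and the
  -- separating functional produces a p with ⟨p, b⟩ - H(s, x, p) > h.
  have hdisj : Disjoint Γ ({-b} ×ˢ Iic h) := by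
    rw [Set.disjoint_left]
    rintro ⟨v, l⟩ hv ⟨rfl, hl⟩
    exact hcon l hl hv
  obtain ⟨φ, u, v, hφ₁, huv, hφ₂⟩ := geometric_hahn_banach_compact_closed (convex_convexHull ℝ _)
    (hF.isCompact_hull hA hs x) ((convex_singleton (-b)).prod (convex_Iic h))
    (isClosed_singleton.prod isClosed_Iic) hdisj
  set q := (InnerProductSpace.toDual ℝ (EuclideanSpace ℝ (Fin n))).symm
    (φ.comp (ContinuousLinearMap.inl ℝ _ ℝ)) with hq
  set μ := φ (0, 1) with hμ
  have hφ : ∀ y l, φ (y, l) = inner ℝ q y + l * μ := fun y l => by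
    have h1 : inner ℝ q y = φ (y, 0) := by
      rw [hq, InnerProductSpace.toDual_symm_apply]; rfl
    have h2 : (y, l) = (y, (0 : ℝ)) + l • ((0 : EuclideanSpace ℝ (Fin n)), (1 : ℝ)) := by simp
    rw [h2, map_add, map_smul, h1, smul_eq_mul]
  -- The hull point (-b, l₀) and a ray point strictly below it share their first component, so the
  -- separation forces a negative vertical slope. The functional can then be normalised to ⟨p, v⟩ +
  -- l.
  have hμ0 : μ < 0 := by
    have h1 := hφ₁ _ hl₀
    have h2 := hφ₂ (-b, min h (l₀ - 1)) ⟨rfl, mem_Iic.2 (min_le_left _ _)⟩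
    rw [hφ] at h1 h2
    have h3 : min h (l₀ - 1) ≤ l₀ - 1 := min_le_right _ _
    by_contra! hc
    nlinarith
  set p := μ⁻¹ • q with hp
  have hqp : q = μ • p := by rw [hp, smul_smul, mul_inv_cancel₀ hμ0.ne, one_smul]
  have hH : hamiltonian A f L s x p ≤ -(u / μ) := by
    refine csSup_le (hA_ne.image _) ?_
    rintro _ ⟨a, ha, rfl⟩
    have h1 := hφ₁ _ (subset_convexHull ℝ _ (mem_image_of_mem _ ha))
    rw [augField, hφ, hqp, inner_smul_left] at h1
    simp only [conj_trivial] at h1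
    have h2 : u / μ < inner ℝ p (f s x a) + L s x a := by
      rw [div_lt_iff_of_neg hμ0]; linarith
    simp only
    linarith
  have h1 := hφ₂ (-b, h) ⟨rfl, mem_Iic.2 le_rfl⟩
  rw [hφ, hqp, inner_smul_left, inner_neg_right] at h1
  simp only [conj_trivial] at h1
  have h2 : -(inner ℝ p b) + h < u / μ := by
    rw [lt_div_iff_of_neg hμ0]; linarith
  have h3 : ((inner ℝ p b - hamiltonian A f L s x p : ℝ) : EReal) ≤ hamiltonianConj A f L s x b :=
    le_iSup (fun p : EuclideanSpace ℝ (Fin n) =>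
      ((inner ℝ p b - hamiltonian A f L s x p : ℝ) : EReal)) p
  rw [hh, EReal.coe_le_coe_iff] at h3
  linarith

theorem hamiltonian_le_add (hF : IsLipField A T K (augField f L)) (hA : IsCompact A)
    (hA_ne : A.Nonempty) {s s' : ℝ} (hs : s ∈ Icc 0 T) (hs' : s' ∈ Icc 0 T)
    (x x' p : EuclideanSpace ℝ (Fin n)) :
    hamiltonian A f L s x p ≤
      hamiltonian A f L s' x' p + (‖p‖ + 1) * (K * (|s - s'| + ‖x - x'‖)) := by
  refine csSup_le (hA_ne.image _) ?_
  rintro _ ⟨a, ha, rfl⟩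
  have h1 := le_hamiltonian hF hA hs' x' p ha
  have h2 := hF.fst.lip a ha s hs s' hs' x x'
  have h3 := hF.snd.lip a ha s hs s' hs' x x'
  have h4 : |inner ℝ p (f s x a - f s' x' a)| ≤ ‖p‖ * (K * (|s - s'| + ‖x - x'‖)) :=
    (abs_real_inner_le_norm _ _).trans (by gcongr)
  rw [inner_sub_right] at h4
  rw [Real.norm_eq_abs] at h3
  simp only
  linarith [abs_le.1 h3, abs_le.1 h4]

theorem continuous_hamiltonian_projIcc (hF : IsLipField A T K (augField f L)) (hA : IsCompact A)
    (hA_ne : A.Nonempty) (hT : 0 ≤ T) (p : EuclideanSpace ℝ (Fin n)) :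
    Continuous fun y : ℝ × EuclideanSpace ℝ (Fin n) =>
      hamiltonian A f L (projIcc 0 T hT y.1) y.2 p := by
  rw [continuous_iff_continuousAt]
  rintro ⟨s₀, x₀⟩
  have hb : Continuous fun y : ℝ × EuclideanSpace ℝ (Fin n) => (‖p‖ + 1) *
      (K * (|(projIcc 0 T hT y.1 : ℝ) - projIcc 0 T hT s₀| + ‖y.2 - x₀‖)) := by
    have : Continuous fun y : ℝ × EuclideanSpace ℝ (Fin n) => (projIcc 0 T hT y.1 : ℝ) :=
      continuous_subtype_val.comp (continuous_projIcc.comp continuous_fst)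
    fun_prop
  have hb' := hb.tendsto (s₀, x₀)
  simp only [sub_self, abs_zero, norm_zero, add_zero, mul_zero] at hb'
  rw [ContinuousAt, tendsto_iff_norm_sub_tendsto_zero]
  refine squeeze_zero (fun _ => norm_nonneg _) (fun y => ?_) hb'
  have h1 := hamiltonian_le_add hF hA hA_ne (projIcc 0 T hT y.1).2 (projIcc 0 T hT s₀).2 y.2 x₀ p
  have h2 := hamiltonian_le_add hF hA hA_ne (projIcc 0 T hT s₀).2 (projIcc 0 T hT y.1).2 x₀ y.2 p
  rw [abs_sub_comm, norm_sub_rev] at h2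
  rw [Real.norm_eq_abs, abs_le]
  constructor <;> linarith

/-- The conjugate is measurable along measurable curves. -/
theorem aemeasurable_hamiltonianConj (hF : IsLipField A T K (augField f L)) (hA : IsCompact A)
    (hA_ne : A.Nonempty) {t : ℝ} (ht : t ∈ Icc 0 T) {x β : ℝ → EuclideanSpace ℝ (Fin n)}
    (hx : AEMeasurable x (volume.restrict (Icc t T)))
    (hβ : AEMeasurable β (volume.restrict (Icc t T))) :
    AEMeasurable (fun s => hamiltonianConj A f L s (x s) (β s)) (volume.restrict (Icc t T)) := by
  have hT : 0 ≤ T := ht.1.trans ht.2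
  -- A supremum of jointly continuous functions is lower semicontinuous, hence Borel. Projecting
  -- time onto [0, T] makes the Hamiltonian continuous on the whole line.
  have hlsc : LowerSemicontinuous
      fun y : ℝ × EuclideanSpace ℝ (Fin n) × EuclideanSpace ℝ (Fin n) =>
        hamiltonianConj A f L (projIcc 0 T hT y.1) y.2.1 y.2.2 := by
    refine lowerSemicontinuous_iSup fun p => Continuous.lowerSemicontinuous ?_
    have h1 : Continuous fun y : ℝ × EuclideanSpace ℝ (Fin n) × EuclideanSpace ℝ (Fin n) =>
        (inner ℝ p y.2.2 : ℝ) := by fun_prop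
    have h2 : Continuous fun y : ℝ × EuclideanSpace ℝ (Fin n) × EuclideanSpace ℝ (Fin n) =>
        hamiltonian A f L (projIcc 0 T hT y.1) y.2.1 p :=
      Continuous.comp (g := fun y : ℝ × EuclideanSpace ℝ (Fin n) =>
        hamiltonian A f L (projIcc 0 T hT y.1) y.2 p)
        (f := fun y : ℝ × EuclideanSpace ℝ (Fin n) × EuclideanSpace ℝ (Fin n) => (y.1, y.2.1))
        (continuous_hamiltonian_projIcc hF hA hA_ne hT p)
        (continuous_fst.prodMk continuous_snd.fst)
    exact continuous_coe_real_ereal.comp (h1.sub h2)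
  refine (hlsc.measurable.comp_aemeasurable (f := fun s => (s, x s, β s))
    (μ := volume.restrict (Icc t T)) (aemeasurable_id.prodMk (hx.prodMk hβ))).congr ?_
  filter_upwards [ae_restrict_mem measurableSet_Icc] with s hs
  simp only [Function.comp_apply]
  rw [projIcc_of_mem hT (Icc_subset_Icc_left ht.1 hs)]

end Hamiltonian

/-! ### Integrability along feasible pairs -/

section Trajectories

variable {n m : ℕ} {A : Set (EuclideanSpace ℝ (Fin m))}
  {f : ℝ → EuclideanSpace ℝ (Fin n) → EuclideanSpace ℝ (Fin m) → EuclideanSpace ℝ (Fin n)}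
  {L : ℝ → EuclideanSpace ℝ (Fin n) → EuclideanSpace ℝ (Fin m) → ℝ}
  {c : ℝ → EuclideanSpace ℝ (Fin n) → ℝ} {T K t ε : ℝ} {x₀ : EuclideanSpace ℝ (Fin n)}

theorem IsTrajectory.continuousOn {x v : ℝ → EuclideanSpace ℝ (Fin n)} (htT : t ≤ T)
    (h : IsTrajectory t T x₀ x v) : ContinuousOn x (Icc t T) := by
  have hi := (intervalIntegrable_iff_integrableOn_Icc_of_le htT).1 h.1
  rw [← uIcc_of_le htT] at hi
  have := intervalIntegral.continuousOn_primitive_interval hi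
  rw [uIcc_of_le htT] at this
  exact (continuousOn_const.add this).congr h.2

theorem IsFeasible.integrableOn_augField {x : ℝ → EuclideanSpace ℝ (Fin n)}
    {α : ℝ → EuclideanSpace ℝ (Fin m)} (h : IsFeasible A f c T ε t x₀ x α)
    (hF : IsLipField A T K (augField f L)) (hA : IsCompact A) (hK : 0 < K) (ht : t ∈ Icc 0 T) :
    IntegrableOn (fun s => augField f L s (x s) (α s)) (Icc t T) :=
  hF.integrableOn hA hK ht (h.dynamics.continuousOn ht.2) h.control.1.1.aemeasurable h.control.2

/-- This recasts a feasible pair as a selection (-β, H^*) of the convexified augmented field, the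
form used by the approximation by controls. -/
theorem IsLaxFeasible.mem_hull {x β : ℝ → EuclideanSpace ℝ (Fin n)}
    (h : IsLaxFeasible A f c T t x₀ x β) (hF : IsLipField A T K (augField f L)) (hA : IsCompact A)
    (hA_ne : A.Nonempty) (ht : t ∈ Icc 0 T) {s : ℝ} (hs : s ∈ Icc t T) :
    hamiltonianConj A f L s (x s) (β s) = (hamiltonianConj A f L s (x s) (β s)).toReal ∧
    (-β s, (hamiltonianConj A f L s (x s) (β s)).toReal) ∈
      convexHull ℝ (augField f L s (x s) '' A) := by
  obtain ⟨l, hl, hmem⟩ := exists_hamiltonianConj_eq hF hA hA_ne (Icc_subset_Icc_left ht.1 hs)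
    (h.control s hs)
  rw [hl, EReal.toReal_coe]
  exact ⟨rfl, hmem⟩

theorem IsLaxFeasible.exists_bound {x β : ℝ → EuclideanSpace ℝ (Fin n)}
    (h : IsLaxFeasible A f c T t x₀ x β) (hF : IsLipField A T K (augField f L)) (hA : IsCompact A)
    (hA_ne : A.Nonempty) (hK : 0 < K) (ht : t ∈ Icc 0 T) :
    ∃ M, 0 ≤ M ∧ (∀ s ∈ Icc t T, ∀ a ∈ A, ‖augField f L s (x s) a‖ ≤ M) ∧
      ∀ s ∈ Icc t T, ‖(-β s, (hamiltonianConj A f L s (x s) (β s)).toReal)‖ ≤ M := by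
  obtain ⟨M, hM, hb⟩ := hF.exists_bound hA (ht.1.trans ht.2) hK
  obtain ⟨R, hR⟩ := isCompact_Icc.exists_bound_of_continuousOn (h.dynamics.continuousOn ht.2)
  have hb' : ∀ s ∈ Icc t T, ∀ a ∈ A, ‖augField f L s (x s) a‖ ≤ M + K * |R| := by
    intro s hs a ha
    refine (hb s (Icc_subset_Icc_left ht.1 hs) _ a ha).trans ?_
    gcongr
    exact (hR s hs).trans (le_abs_self R)
  refine ⟨M + K * |R|, by positivity, hb', fun s hs => ?_⟩
  have hsub : convexHull ℝ (augField f L s (x s) '' A) ⊆ Metric.closedBall 0 (M + K * |R|) := by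
    refine convexHull_min ?_ (convex_closedBall _ _)
    rintro _ ⟨a, ha, rfl⟩
    exact mem_closedBall_zero_iff.2 (hb' s hs a ha)
  exact mem_closedBall_zero_iff.1 (hsub (h.mem_hull hF hA hA_ne ht hs).2)

theorem IsLaxFeasible.intervalIntegrable {x β : ℝ → EuclideanSpace ℝ (Fin n)}
    (h : IsLaxFeasible A f c T t x₀ x β) (hF : IsLipField A T K (augField f L)) (hA : IsCompact A)
    (hA_ne : A.Nonempty) (hK : 0 < K) (ht : t ∈ Icc 0 T) :
    IntervalIntegrable (fun s => (-β s, (hamiltonianConj A f L s (x s) (β s)).toReal))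
      volume t T := by
  obtain ⟨M, -, -, hM⟩ := h.exists_bound hF hA hA_ne hK ht
  rw [intervalIntegrable_iff_integrableOn_Icc_of_le ht.2]
  have hβ : AEMeasurable (fun s => -β s) (volume.restrict (Icc t T)) :=
    ((intervalIntegrable_iff_integrableOn_Icc_of_le ht.2).1 h.dynamics.1).1.aemeasurable
  have hβ' : AEMeasurable β (volume.restrict (Icc t T)) :=
    hβ.neg.congr (ae_of_all _ fun s => by simp)
  have hx := (h.dynamics.continuousOn ht.2).aemeasurable (μ := volume) measurableSet_Icc
  refine Integrable.of_bound (hβ.prodMk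
    (aemeasurable_hamiltonianConj hF hA hA_ne ht hx hβ').ereal_toReal).aestronglyMeasurable M ?_
  filter_upwards [ae_restrict_mem measurableSet_Icc] with s hs using hM s hs

end Trajectories

/-! ### Limits of almost feasible trajectories -/

section Compactness

variable {n m : ℕ} {A : Set (EuclideanSpace ℝ (Fin m))}
  {f : ℝ → EuclideanSpace ℝ (Fin n) → EuclideanSpace ℝ (Fin m) → EuclideanSpace ℝ (Fin n)}
  {L : ℝ → EuclideanSpace ℝ (Fin n) → EuclideanSpace ℝ (Fin m) → ℝ}
  {c : ℝ → EuclideanSpace ℝ (Fin n) → ℝ} {T K t : ℝ} {x₀ : EuclideanSpace ℝ (Fin n)}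

theorem fst_intervalIntegral {V : Type*} [NormedAddCommGroup V] [NormedSpace ℝ V] [CompleteSpace V]
    {w : ℝ → V × ℝ} {a b : ℝ} (hw : IntervalIntegrable w volume a b) :
    (∫ s in a..b, w s).1 = ∫ s in a..b, (w s).1 :=
  ((ContinuousLinearMap.fst ℝ V ℝ).intervalIntegral_comp_comm hw).symm

theorem snd_intervalIntegral {V : Type*} [NormedAddCommGroup V] [NormedSpace ℝ V] [CompleteSpace V]
    {w : ℝ → V × ℝ} {a b : ℝ} (hw : IntervalIntegrable w volume a b) :
    (∫ s in a..b, w s).2 = ∫ s in a..b, (w s).2 :=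
  ((ContinuousLinearMap.snd ℝ V ℝ).intervalIntegral_comp_comm hw).symm

/-- Feasible trajectories from a given initial point are bounded, uniformly in the control. -/
theorem exists_forall_norm_le (hF : IsLipField A T K f) (hA : IsCompact A) (hK : 0 < K)
    (ht : t ∈ Icc 0 T) (x₀ : EuclideanSpace ℝ (Fin n)) :
    ∃ R, 0 ≤ R ∧ ∀ ε x α, IsFeasible A f c T ε t x₀ x α → ∀ s ∈ Icc t T, ‖x s‖ ≤ R := by
  obtain ⟨M, hM, hb⟩ := hF.exists_bound hA (ht.1.trans ht.2) hK
  have hTt : 0 ≤ T - t := sub_nonneg.2 ht.2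
  refine ⟨2 * (‖x₀‖ + M * (T - t)) * Real.exp (2 * K * (T - t)), by positivity,
    fun ε x α h => ?_⟩
  have hx := h.dynamics.continuousOn ht.2
  refine le_of_le_add_mul_integral hK (by positivity) hx.norm fun s hs => ?_
  have hxi : IntervalIntegrable (fun τ => ‖x τ‖) volume t s := by
    apply ContinuousOn.intervalIntegrable
    rw [uIcc_of_le hs.1]
    exact (hx.mono (Icc_subset_Icc_right hs.2)).norm
  have h1 : ‖∫ τ in t..s, f τ (x τ) (α τ)‖ ≤ ∫ τ in t..s, (M + K * ‖x τ‖) := by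
    refine intervalIntegral.norm_integral_le_of_norm_le hs.1 (ae_of_all _ fun τ hτ => ?_)
      (intervalIntegrable_const.add (hxi.const_mul K))
    have hτ' : τ ∈ Icc t T := ⟨hτ.1.le, hτ.2.trans hs.2⟩
    exact hb τ (Icc_subset_Icc_left ht.1 hτ') _ _ (h.control.2 τ hτ')
  rw [intervalIntegral.integral_add intervalIntegrable_const (hxi.const_mul K),
    intervalIntegral.integral_const, intervalIntegral.integral_const_mul, smul_eq_mul] at h1
  have h2 : (s - t) * M ≤ M * (T - t) := by
    rw [mul_comm]; gcongr; exact hs.2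
  calc ‖x s‖ = ‖x₀ + ∫ τ in t..s, f τ (x τ) (α τ)‖ := by rw [← h.dynamics.2 s hs]
    _ ≤ ‖x₀‖ + ‖∫ τ in t..s, f τ (x τ) (α τ)‖ := norm_add_le _ _
    _ ≤ _ := by linarith

/-- A right difference quotient of a primitive of the field along `x`, `α` is close to the convex
hull of the values of the field at the left end point. -/
theorem infDist_slope_le {E U W : Type*} [NormedAddCommGroup E] [NormedAddCommGroup U]
    [NormedAddCommGroup W] [NormedSpace ℝ W] [CompleteSpace W] {A : Set U} {F : ℝ → E → U → W}
    (hF : IsLipField A T K F) (hA_ne : A.Nonempty) (hK : 0 < K) {s h M : ℝ} (hh : 0 < h)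
    (hs : 0 ≤ s) (hsT : s + h ≤ T) {x : ℝ → E} {α : ℝ → U} (hM : 0 ≤ M)
    (hx : ∀ τ ∈ Icc s (s + h), ‖x τ - x s‖ ≤ M * (τ - s)) (hα : ∀ τ ∈ Icc s (s + h), α τ ∈ A)
    (hi : IntervalIntegrable (fun τ => F τ (x τ) (α τ)) volume s (s + h)) (y : E) :
    Metric.infDist (h⁻¹ • ∫ τ in s..s + h, F τ (x τ) (α τ)) (convexHull ℝ (F s y '' A)) ≤
      K * (h + (M * h + ‖x s - y‖)) := by
  have := infDist_average_le (convex_convexHull ℝ (F s y '' A)) (hA_ne.image _).convexHull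
    (lt_add_of_pos_right s hh) hi (r := K * (h + (M * h + ‖x s - y‖))) fun τ hτ => ?_
  · rwa [add_sub_cancel_left] at this
  · have hsI : s ∈ Icc 0 T := ⟨hs, by linarith⟩
    have hτI : τ ∈ Icc 0 T := ⟨hs.trans hτ.1, hτ.2.trans hsT⟩
    refine (hF.infDist_hull_le hA_ne hK hτI hsI (x τ) y
      (subset_convexHull ℝ _ (mem_image_of_mem _ (hα τ hτ)))).trans ?_
    have h1 : |τ - s| ≤ h := by rw [abs_of_nonneg (sub_nonneg.2 hτ.1)]; linarith [hτ.2]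
    have h2 : ‖x τ - y‖ ≤ M * h + ‖x s - y‖ := by
      refine (norm_sub_le_norm_sub_add_norm_sub _ (x s) _).trans ?_
      gcongr
      refine (hx τ hτ).trans ?_
      gcongr
      linarith [hτ.2]
    gcongr

/-- Limits of almost feasible pairs are feasible for the transformed problem, at no greater cost. -/
theorem laxValue_le_of_forall_exists (hF : IsLipField A T K (augField f L)) (hA : IsCompact A)
    (hA_ne : A.Nonempty) (hK : 0 < K) {g : EuclideanSpace ℝ (Fin n) → ℝ} (hg : Continuous g)
    (hc : ∀ s ∈ Icc 0 T, Continuous (c s)) (ht : t ∈ Icc 0 T) {q : ℝ}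
    (hq : ∀ ε > 0, ∃ x α, IsFeasible A f c T ε t x₀ x α ∧
      (∫ s in t..T, L s (x s) (α s)) + g (x T) ≤ q) :
    laxValue A f L g c T t x₀ ≤ q := by
  have htT := ht.2
  have hsub : Icc t T ⊆ Icc 0 T := Icc_subset_Icc_left ht.1
  obtain ⟨R, hR, hbd⟩ := exists_forall_norm_le (c := c) hF.fst hA hK ht x₀
  obtain ⟨M₀, hM₀, hMb⟩ := hF.exists_bound hA (ht.1.trans ht.2) hK
  set M := M₀ + K * R with hMdef
  have hM : 0 ≤ M := by positivity
  choose x α hfeas hcost using fun k : ℕ => hq (1 / ((k : ℝ) + 1)) (by positivity)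
  let w : ℕ → ℝ → EuclideanSpace ℝ (Fin n) × ℝ := fun k s => augField f L s (x k s) (α k s)
  have hwi : ∀ k, ∀ a ∈ Icc t T, ∀ b ∈ Icc t T, IntervalIntegrable (w k) volume a b := by
    intro k a ha b hb
    refine (((intervalIntegrable_iff_integrableOn_Icc_of_le htT).2
      ((hfeas k).integrableOn_augField hF hA hK ht)).mono_set ?_)
    rw [uIcc_of_le htT]
    exact ordConnected_Icc.uIcc_subset ha hb
  have hwM : ∀ k, ∀ s ∈ Icc t T, ‖w k s‖ ≤ M := fun k s hs => by
    refine (hMb s (hsub hs) _ _ ((hfeas k).control.2 s hs)).trans ?_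
    rw [hMdef]
    gcongr
    exact hbd _ _ _ (hfeas k) s hs
  -- X k carries the trajectory and its running cost together; all X k are M-Lipschitz on [t, T].
  -- Pointwise limits along an ultrafilter suffice, with no need for a uniformly convergent
  -- subsequence.
  let X : ℕ → ℝ → EuclideanSpace ℝ (Fin n) × ℝ := fun k s => (x₀, 0) + ∫ τ in t..s, w k τ
  have htI : t ∈ Icc t T := ⟨le_rfl, htT⟩
  have hTI : T ∈ Icc t T := ⟨htT, le_rfl⟩
  have hXsub : ∀ k, ∀ a ∈ Icc t T, ∀ b ∈ Icc t T, X k b - X k a = ∫ τ in a..b, w k τ := by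
    intro k a ha b hb
    simp only [X, add_sub_add_left_eq_sub]
    exact intervalIntegral.integral_interval_sub_left (hwi k t htI b hb) (hwi k t htI a ha)
  have hXlip : ∀ k, ∀ a ∈ Icc t T, ∀ b ∈ Icc t T, ‖X k b - X k a‖ ≤ M * |b - a| := by
    intro k a ha b hb
    rw [hXsub k a ha b hb]
    exact intervalIntegral.norm_integral_le_of_norm_le_const fun τ hτ =>
      hwM k τ (ordConnected_Icc.uIcc_subset ha hb (uIoc_subset_uIcc hτ))
  have hX1 : ∀ k, ∀ s ∈ Icc t T, (X k s).1 = x k s := by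
    intro k s hs
    rw [(hfeas k).dynamics.2 s hs]
    simp only [X, Prod.fst_add]
    rw [fst_intervalIntegral (hwi k t htI s hs)]
    rfl
  have hX2 : ∀ k, (X k T).2 = ∫ s in t..T, L s (x k s) (α k s) := by
    intro k
    simp only [X, Prod.snd_add, zero_add]
    rw [snd_intervalIntegral (hwi k t htI T hTI)]
    rfl
  -- the limit along an ultrafilter
  have hlim : ∀ s : ℝ, ∃ y, Tendsto (fun k => X k (projIcc t T htT s)) (hyperfilter ℕ) (𝓝 y) := by
    intro s
    have hcpt := isCompact_closedBall (X 0 t) (M * |(projIcc t T htT s : ℝ) - t|)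
    have hev : ∀ k, X k (projIcc t T htT s) ∈
        Metric.closedBall (X 0 t) (M * |(projIcc t T htT s : ℝ) - t|) := fun k => by
      have h0 : X 0 t = X k t := by simp [X]
      rw [Metric.mem_closedBall, dist_eq_norm, h0]
      exact hXlip k t htI _ (projIcc t T htT s).2
    obtain ⟨y, -, hy⟩ := hcpt.ultrafilter_le_nhds
      ((hyperfilter ℕ).map fun k => X k (projIcc t T htT s))
      (le_principal_iff.2 (Filter.mem_map.2 (Eventually.of_forall hev)))
    exact ⟨y, hy⟩
  choose Y hY using hlim
  have hY' : ∀ s ∈ Icc t T, Tendsto (fun k => X k s) (hyperfilter ℕ) (𝓝 (Y s)) := by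
    intro s hs
    have := hY s
    rwa [projIcc_of_mem htT hs] at this
  have hYx : ∀ s ∈ Icc t T, Tendsto (fun k => x k s) (hyperfilter ℕ) (𝓝 (Y s).1) := by
    intro s hs
    refine ((continuous_fst.tendsto (Y s)).comp (hY' s hs)).congr fun k => ?_
    exact hX1 k s hs
  have hYlip : LipschitzWith M.toNNReal Y := by
    refine LipschitzWith.of_dist_le_mul fun a b => ?_
    refine le_of_tendsto ((hY a).dist (hY b)) (Eventually.of_forall fun k => ?_)
    rw [dist_eq_norm, Real.coe_toNNReal M hM]
    refine (hXlip k _ (projIcc t T htT b).2 _ (projIcc t T htT a).2).trans ?_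
    gcongr
    have := (LipschitzWith.projIcc htT).dist_le_mul a b
    simpa [Subtype.dist_eq, Real.dist_eq] using this
  have hYt : Y t = (x₀, 0) := by
    refine tendsto_nhds_unique (hY' t htI) ?_
    simp [X]
  -- Difference quotients of X k lie within K(h + Mh + ‖x k s - (Y s).1‖) of the hull frozen at (s,
  -- (Y s).1). Pass to the limit in k, then let h ↓ 0.
  have hderiv : ∀ s ∈ Ioo t T, DifferentiableAt ℝ Y s →
      deriv Y s ∈ convexHull ℝ (augField f L s (Y s).1 '' A) := by
    intro s hs hd
    have hsI : s ∈ Icc t T := Ioo_subset_Icc_self hs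
    have hcl := (hF.isCompact_hull hA (hsub hsI) (Y s).1).isClosed
    rw [hcl.mem_iff_infDist_zero (hA_ne.image _).convexHull]
    refine le_antisymm ?_ Metric.infDist_nonneg
    have hslope := hd.hasDerivAt.tendsto_slope_zero_right
    have hbound : Tendsto (fun h : ℝ => K * (h + M * h)) (𝓝[>] 0) (𝓝 0) := by
      have : Continuous fun h : ℝ => K * (h + M * h) := by fun_prop
      simpa using (this.tendsto 0).mono_left nhdsWithin_le_nhds
    refine le_of_tendsto_of_tendsto
      ((Metric.continuous_infDist_pt (convexHull ℝ (augField f L s (Y s).1 '' A))).continuousAt.tendsto.comp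
        hslope) hbound ?_
    filter_upwards [Ioo_mem_nhdsGT (sub_pos.2 hs.2)] with h hh
    have hshI : s + h ∈ Icc t T := ⟨by linarith [hs.1, hh.1], by linarith [hh.2]⟩
    have hIcc : Icc s (s + h) ⊆ Icc t T := Icc_subset_Icc hs.1.le hshI.2
    have hk : ∀ k, Metric.infDist (h⁻¹ • (X k (s + h) - X k s))
        (convexHull ℝ (augField f L s (Y s).1 '' A)) ≤ K * (h + (M * h + ‖x k s - (Y s).1‖)) := by
      intro k
      rw [hXsub k s hsI _ hshI]
      refine infDist_slope_le hF hA_ne hK hh.1 (hsub hsI).1 hshI.2 hM (fun τ hτ => ?_)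
        (fun τ hτ => (hfeas k).control.2 τ (hIcc hτ)) (hwi k s hsI _ hshI) _
      rw [← hX1 k τ (hIcc hτ), ← hX1 k s hsI, ← abs_of_nonneg (sub_nonneg.2 hτ.1)]
      exact (norm_fst_le _).trans (hXlip k s hsI τ (hIcc hτ))
    have hl := (Metric.continuous_infDist_pt
      (convexHull ℝ (augField f L s (Y s).1 '' A))).continuousAt.tendsto.comp
        (((hY' _ hshI).sub (hY' s hsI)).const_smul h⁻¹)
    have hr : Tendsto (fun k => K * (h + (M * h + ‖x k s - (Y s).1‖))) (hyperfilter ℕ)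
        (𝓝 (K * (h + M * h))) := by
      have := ((hYx s hsI).sub_const (Y s).1).norm
      rw [sub_self, norm_zero] at this
      simpa using ((this.const_add (M * h)).const_add h).const_mul K
    exact le_of_tendsto_of_tendsto hl hr (Eventually.of_forall hk)
  have hae : ∀ᵐ s ∂volume.restrict (Icc t T),
      deriv Y s ∈ convexHull ℝ (augField f L s (Y s).1 '' A) := by
    rw [← restrict_Ioo_eq_restrict_Icc]
    filter_upwards [ae_restrict_mem measurableSet_Ioo,
      ae_restrict_of_ae (hYlip.ae_differentiableAt (μ := volume))] with s hs hd
    exact hderiv s hs hd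
  have hYi := intervalIntegrable_deriv_of_lipschitz hYlip
  obtain ⟨a₀, ha₀⟩ := hA_ne
  classical
  -- Feasibility requires the hull constraint at every time, so β takes an arbitrary admissible
  -- value on the null set where Y' fails to lie in the hull.
  let β : ℝ → EuclideanSpace ℝ (Fin n) := fun s =>
    if deriv Y s ∈ convexHull ℝ (augField f L s (Y s).1 '' A) then -(deriv Y s).1
    else -f s (Y s).1 a₀
  have hβae : ∀ᵐ s ∂volume.restrict (Icc t T), (deriv Y s).1 = -β s := by
    filter_upwards [hae] with s hs
    simp [β, hs]
  have hlax : IsLaxFeasible A f c T t x₀ (fun s => (Y s).1) β := by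
    refine ⟨⟨?_, fun s hs => ?_⟩, fun s hs => ?_, fun s hs => ?_⟩
    · rw [intervalIntegrable_iff_integrableOn_Icc_of_le htT]
      exact ((intervalIntegrable_iff_integrableOn_Icc_of_le htT).1 (hYi t T)).fst.congr hβae
    · have h1 := integral_deriv_eq_sub_of_lipschitz hYlip t s
      have h2 : ∫ τ in t..s, -β τ = (∫ τ in t..s, deriv Y τ).1 := by
        rw [fst_intervalIntegral (hYi t s)]
        refine intervalIntegral.integral_congr_ae_restrict ?_
        rw [uIoc_of_le hs.1]
        refine ae_mono (Measure.restrict_mono ?_ le_rfl) (hβae.mono fun _ h => h.symm)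
        exact fun τ hτ => ⟨hτ.1.le, hτ.2.trans hs.2⟩
      rw [h2, h1, hYt]
      simp
    · rw [mem_convexHull_controlSet]
      by_cases hmem : deriv Y s ∈ convexHull ℝ (augField f L s (Y s).1 '' A)
      · simp only [β, if_pos hmem, neg_neg]
        exact fst_mem_of_mem_hull hmem
      · simp only [β, if_neg hmem, neg_neg]
        exact subset_convexHull ℝ _ (mem_image_of_mem _ ha₀)
    · have h1 := ((hc s (hsub hs)).tendsto (Y s).1).comp (hYx s hs)
      have h2 : Tendsto (fun k : ℕ => 1 / ((k : ℝ) + 1)) (hyperfilter ℕ) (𝓝 0) :=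
        tendsto_one_div_add_atTop_nhds_zero_nat.mono_left (by
          rw [← Nat.cofinite_eq_atTop]; exact hyperfilter_le_cofinite)
      exact le_of_tendsto_of_tendsto h1 h2 (Eventually.of_forall fun k => (hfeas k).state s hs)
  have hval : laxValue A f L g c T t x₀ ≤
      (((∫ s in t..T, (hamiltonianConj A f L s (Y s).1 (β s)).toReal) + g (Y T).1 : ℝ) : EReal) :=
    sInf_le ⟨fun s => (Y s).1, β, hlax, rfl⟩
  refine hval.trans (EReal.coe_le_coe_iff.2 ?_)
  have hA_ne : A.Nonempty := ⟨a₀, ha₀⟩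
  have hint := hlax.intervalIntegrable hF hA hA_ne hK ht
  -- H^* is the lowest height of the hull above the velocity, so it cannot exceed the limiting cost
  -- rate, the second component of Y'.
  have hle : ∫ s in t..T, (hamiltonianConj A f L s (Y s).1 (β s)).toReal ≤
      ∫ s in t..T, (deriv Y s).2 := by
    refine intervalIntegral.integral_mono_ae_restrict htT
      ((intervalIntegrable_iff_integrableOn_Icc_of_le htT).2
        ((intervalIntegrable_iff_integrableOn_Icc_of_le htT).1 hint).snd)
      ((intervalIntegrable_iff_integrableOn_Icc_of_le htT).2
        ((intervalIntegrable_iff_integrableOn_Icc_of_le htT).1 (hYi t T)).snd) ?_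
    filter_upwards [hae, ae_restrict_mem measurableSet_Icc] with s hs hsI
    have h1 := hamiltonianConj_le_of_mem_hull hF hA (hsub hsI)
      (show ((deriv Y s).1, (deriv Y s).2) ∈ _ from hs)
    have h2 : β s = -(deriv Y s).1 := by simp [β, hs]
    rw [h2]
    have h3 := hlax.mem_hull hF hA hA_ne ht hsI
    rw [← h2] at h1 ⊢
    rwa [h3.1, EReal.coe_le_coe_iff] at h1
  have hfinal : (Y T).2 + g (Y T).1 ≤ q := by
    refine le_of_tendsto (((continuous_snd.tendsto (Y T)).comp (hY' T hTI)).add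
      ((hg.tendsto _).comp (hYx T hTI))) (Eventually.of_forall fun k => ?_)
    simp only [Function.comp_apply, hX2]
    exact hcost k
  have h2 := integral_deriv_eq_sub_of_lipschitz hYlip t T
  have h3 := congrArg Prod.snd h2
  rw [snd_intervalIntegral (hYi t T), hYt] at h3
  simp only [Prod.snd_sub, sub_zero] at h3
  linarith

end Compactness

/-! ### Approximation of convexified selections by ordinary controls -/

section Chattering

/-- Controls can be glued along a uniform grid. -/
theorem exists_measurable_eq_on_grid {U : Type*} [MeasurableSpace U] {A : Set U} {t η : ℝ} (α : ℕ → ℝ → U) (hα : ∀ j, Measurable (α j))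
    (hαA : ∀ j s, α j s ∈ A) :
    ∃ β : ℝ → U, Measurable β ∧ (∀ s, β s ∈ A) ∧
      ∀ (j : ℕ), ∀ s ∈ Ioc (t + j * η) (t + (j + 1) * η), β s = α j s := by
  -- On the half-open cell (t + jη, t + (j+1)η] the ceiling equals j + 1, hence the subtraction of
  -- one. Measurability holds because the index is countable.
  refine ⟨fun s => α (⌈(s - t) / η⌉₊ - 1) s, ?_, fun s => hαA _ _, fun j s hs => ?_⟩
  · have h1 : Measurable fun p : ℝ × ℕ => α p.2 p.1 := measurable_from_prod_countable_left hα
    have h2 : Measurable fun s : ℝ => ⌈(s - t) / η⌉₊ - 1 :=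
      (measurable_from_top (f := fun k : ℕ => k - 1)).comp
        (Nat.measurable_ceil.comp ((measurable_id.sub_const t).div_const η))
    exact h1.comp (measurable_id.prodMk h2)
  · have hη : 0 < η := by
      have := hs.1.trans_le hs.2
      nlinarith
    have : ⌈(s - t) / η⌉₊ = j + 1 := by
      rw [Nat.ceil_eq_iff (by omega), lt_div_iff₀ hη, div_le_iff₀ hη]
      simp only [Nat.add_sub_cancel]
      push_cast
      constructor <;> linarith [hs.1, hs.2]
    simp [this]

variable {E U W : Type*} [NormedAddCommGroup E] [MeasurableSpace E] [BorelSpace E]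
  [SecondCountableTopology E]
  [NormedAddCommGroup U] [MeasurableSpace U] [BorelSpace U] [SecondCountableTopology U]
  [NormedAddCommGroup W] [MeasurableSpace W] [BorelSpace W] [SecondCountableTopology W]
  {A : Set U} {F : ℝ → E → U → W} {T K M t : ℝ} {x : ℝ → E} {w : ℝ → W}

theorem IsLipField.intervalIntegrable (hF : IsLipField A T K F) (hA : IsCompact A) (hK : 0 < K)
    (ht : t ∈ Icc 0 T) {α : ℝ → U} (hx : ContinuousOn x (Icc t T)) (hα : Measurable α)
    (hαA : ∀ s, α s ∈ A) {a b : ℝ} (ha : a ∈ Icc t T) (hb : b ∈ Icc t T) :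
    IntervalIntegrable (fun s => F s (x s) (α s)) volume a b := by
  refine ((intervalIntegrable_iff_integrableOn_Icc_of_le ht.2).2 (hF.integrableOn hA hK ht hx
    hα.aemeasurable fun s _ => hαA s)).mono_set ?_
  rw [uIcc_of_le ht.2]
  exact ordConnected_Icc.uIcc_subset ha hb

variable [NormedSpace ℝ W] [FiniteDimensional ℝ W]

/-- On a short interval, some control reproduces the integral of a selection of the convexified
field up to second order. -/
theorem exists_control_norm_integral_sub_le (hF : IsLipField A T K F) (hA : IsCompact A)
    (hA_ne : A.Nonempty) (hK : 0 < K) (ht : t ∈ Icc 0 T) (hM : 0 ≤ M)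
    (hx : ContinuousOn x (Icc t T))
    (hxM : ∀ a ∈ Icc t T, ∀ b ∈ Icc t T, ‖x a - x b‖ ≤ M * |a - b|)
    (hw : IntervalIntegrable w volume t T)
    (hwΓ : ∀ s ∈ Icc t T, w s ∈ convexHull ℝ (F s (x s) '' A)) {a b : ℝ}
    (ha : a ∈ Icc t T) (hb : b ∈ Icc t T) (hab : a ≤ b) :
    ∃ α : ℝ → U, Measurable α ∧ (∀ s, α s ∈ A) ∧
      ‖∫ s in a..b, (F s (x s) (α s) - w s)‖ ≤ 2 * K * (1 + M) * (b - a) * (b - a) := by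
  have := FiniteDimensional.complete ℝ W
  rcases hab.eq_or_lt with rfl | hlt
  · obtain ⟨a₀, ha₀⟩ := hA_ne
    exact ⟨fun _ => a₀, measurable_const, fun _ => ha₀, by simp⟩
  have hsub : Icc t T ⊆ Icc 0 T := Icc_subset_Icc_left ht.1
  have hIcc : Icc a b ⊆ Icc t T := Icc_subset_Icc ha.1 hb.2
  have hwab : IntervalIntegrable w volume a b := hw.mono_set (by
    rw [uIcc_of_le ht.2, uIcc_of_le hab]; exact hIcc)
  set Γ := convexHull ℝ (F a (x a) '' A)
  have hne : Γ.Nonempty := (hA_ne.image _).convexHull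
  set r := K * (1 + M) * (b - a) with hr
  have hdist : ∀ s ∈ Icc a b, K * (|s - a| + ‖x s - x a‖) ≤ r := by
    intro s hs
    have h1 := hxM s (hIcc hs) a ha
    rw [abs_of_nonneg (sub_nonneg.2 hs.1)] at h1 ⊢
    calc K * (s - a + ‖x s - x a‖) ≤ K * (s - a + M * (s - a)) := by gcongr
      _ = K * (1 + M) * (s - a) := by ring
      _ ≤ r := by rw [hr]; gcongr; exact hs.2
  have havg := infDist_average_le (convex_convexHull ℝ _) hne hlt hwab fun s hs =>
    (hF.infDist_hull_le hA_ne hK (hsub (hIcc hs)) (hsub ha) (x s) (x a) (hwΓ s (hIcc hs))).trans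
      (hdist s hs)
  -- The average of w is within r of the hull frozen at the left end point. Its nearest point v is
  -- reproduced exactly by a control for the frozen field; unfreezing costs another r.
  obtain ⟨v, hv, hvd⟩ := (hF.isCompact_hull hA (hsub ha) (x a)).exists_infDist_eq_dist hne
    ((b - a)⁻¹ • ∫ s in a..b, w s)
  rw [hvd, dist_eq_norm] at havg
  obtain ⟨α, hα, hαA, hαi, hαv⟩ := exists_control_integral_eq hv a b hab
  refine ⟨α, hα, hαA, ?_⟩
  have hFi : IntervalIntegrable (fun s => F s (x s) (α s)) volume a b :=
    hF.intervalIntegrable hA hK ht hx hα hαA ha hb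
  have hba : 0 < b - a := sub_pos.2 hlt
  have hsplit : ∫ s in a..b, (F s (x s) (α s) - w s) =
      (∫ s in a..b, (F s (x s) (α s) - F a (x a) (α s))) -
        (b - a) • ((b - a)⁻¹ • (∫ s in a..b, w s) - v) := by
    rw [intervalIntegral.integral_sub hFi hwab, intervalIntegral.integral_sub hFi (hαi a b), hαv,
      smul_sub, smul_smul, mul_inv_cancel₀ hba.ne', one_smul]
    abel
  rw [hsplit]
  refine (norm_sub_le _ _).trans ?_
  have h1 : ‖∫ s in a..b, (F s (x s) (α s) - F a (x a) (α s))‖ ≤ r * |b - a| := by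
    refine intervalIntegral.norm_integral_le_of_norm_le_const fun s hs => ?_
    rw [uIoc_of_le hab] at hs
    have hs' := Ioc_subset_Icc_self hs
    exact (hF.lip _ (hαA s) _ (hsub (hIcc hs')) _ (hsub ha) _ _).trans (hdist s hs')
  have h2 : ‖(b - a) • ((b - a)⁻¹ • (∫ s in a..b, w s) - v)‖ ≤ (b - a) * r := by
    rw [norm_smul, Real.norm_of_nonneg hba.le]
    gcongr
  rw [abs_of_pos hba] at h1
  calc _ ≤ r * (b - a) + (b - a) * r := add_le_add h1 h2
    _ = _ := by rw [hr]; ring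

/-- A selection of the convexified field along `x` is approximated, in the sense of uniformly small
primitives, by the field along `x` with an ordinary control. -/
theorem exists_control_forall_norm_integral_sub_le (hF : IsLipField A T K F) (hA : IsCompact A)
    (hA_ne : A.Nonempty) (hK : 0 < K) (ht : t ∈ Icc 0 T) (hM : 0 ≤ M)
    (hx : ContinuousOn x (Icc t T))
    (hxM : ∀ a ∈ Icc t T, ∀ b ∈ Icc t T, ‖x a - x b‖ ≤ M * |a - b|)
    (hFM : ∀ s ∈ Icc t T, ∀ a ∈ A, ‖F s (x s) a‖ ≤ M)
    (hw : IntervalIntegrable w volume t T) (hwM : ∀ s ∈ Icc t T, ‖w s‖ ≤ M)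
    (hwΓ : ∀ s ∈ Icc t T, w s ∈ convexHull ℝ (F s (x s) '' A)) {δ : ℝ} (hδ : 0 < δ) :
    ∃ α : ℝ → U, Measurable α ∧ (∀ s, α s ∈ A) ∧
      ∀ s ∈ Icc t T, ‖∫ τ in t..s, (F τ (x τ) (α τ) - w τ)‖ ≤ δ := by
  have htI : t ∈ Icc t T := ⟨le_rfl, ht.2⟩
  rcases ht.2.eq_or_lt with rfl | hlt
  · obtain ⟨a₀, ha₀⟩ := hA_ne
    refine ⟨fun _ => a₀, measurable_const, fun _ => ha₀, fun s hs => ?_⟩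
    rw [Icc_self, mem_singleton_iff] at hs
    simp [hs, hδ.le]
  have hTt : 0 < T - t := sub_pos.2 hlt
  -- The N full cells contribute at most N · 2K(1+M)η² = 2K(1+M)(T-t)η, and the last incomplete cell
  -- at most 2Mη; the total is Cη.
  set C := 2 * K * (1 + M) * (T - t) + 2 * M with hC
  have hC0 : 0 ≤ C := by positivity
  obtain ⟨N, hN⟩ := exists_nat_gt (C * (T - t) / δ)
  have hN0 : (0 : ℝ) < N := lt_of_le_of_lt (by positivity) hN
  set η := (T - t) / N with hη
  have hη0 : 0 < η := by positivity
  have hNη : N * η = T - t := by rw [hη]; field_simp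
  have hCη : C * η ≤ δ := by
    rw [div_lt_iff₀ hδ] at hN
    rw [hη, ← mul_div_assoc, div_le_iff₀ hN0]
    linarith
  have hgrid : ∀ j : ℕ, j ≤ N → t + j * η ∈ Icc t T := by
    intro j hj
    have h1 : (j : ℝ) * η ≤ N * η := by gcongr
    exact ⟨by linarith [show (0 : ℝ) ≤ j * η by positivity], by linarith⟩
  have hcell : ∀ j : ℕ, ∃ α : ℝ → U, Measurable α ∧ (∀ s, α s ∈ A) ∧ (j < N →
      ‖∫ s in (t + j * η)..(t + (j + 1) * η), (F s (x s) (α s) - w s)‖ ≤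
        2 * K * (1 + M) * η * η) := by
    intro j
    by_cases hj : j < N
    · have h1 := hgrid (j + 1) hj
      push_cast at h1
      obtain ⟨α, h2, h3, h4⟩ := exists_control_norm_integral_sub_le hF hA hA_ne hK ht hM hx hxM hw
        hwΓ (hgrid j hj.le) h1 (by linarith)
      refine ⟨α, h2, h3, fun _ => h4.trans_eq ?_⟩
      ring
    · obtain ⟨a₀, ha₀⟩ := hA_ne
      exact ⟨fun _ => a₀, measurable_const, fun _ => ha₀, fun h => absurd h hj⟩
  choose αs hαm hαA hαb using hcell
  obtain ⟨α, hm, hmA, hα⟩ := exists_measurable_eq_on_grid (t := t) (η := η) αs hαm hαA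
  have hint : ∀ a ∈ Icc t T, ∀ b ∈ Icc t T,
      IntervalIntegrable (fun s => F s (x s) (α s) - w s) volume a b := by
    intro a ha b hb
    refine (hF.intervalIntegrable hA hK ht hx hm hmA ha hb).sub (hw.mono_set ?_)
    rw [uIcc_of_le ht.2]
    exact ordConnected_Icc.uIcc_subset ha hb
  have hind : ∀ j : ℕ, j ≤ N → ‖∫ s in t..(t + j * η), (F s (x s) (α s) - w s)‖ ≤
      j * (2 * K * (1 + M) * η * η) := by
    intro j
    induction j with
    | zero => simp
    | succ j ih =>
      intro hj
      have h1 := hgrid j (by omega)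
      have h2 := hgrid (j + 1) hj
      rw [← intervalIntegral.integral_add_adjacent_intervals (hint t htI _ h1) (hint _ h1 _ h2)]
      refine (norm_add_le _ _).trans ?_
      have h3 := hαb j hj
      have h4 : ∫ s in (t + j * η)..(t + ((j + 1 : ℕ) : ℝ) * η), (F s (x s) (α s) - w s) =
          ∫ s in (t + j * η)..(t + (j + 1) * η), (F s (x s) (αs j s) - w s) := by
        push_cast
        refine intervalIntegral.integral_congr_ae (ae_of_all _ fun s hs => ?_)
        rw [uIoc_of_le (by linarith)] at hs
        rw [hα j s hs]
      rw [h4]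
      push_cast
      linarith [ih (by omega)]
  refine ⟨α, hm, hmA, fun s hs => ?_⟩
  set j := ⌊(s - t) / η⌋₊ with hj
  have hst : 0 ≤ (s - t) / η := div_nonneg (sub_nonneg.2 hs.1) hη0.le
  have hj1 : j * η ≤ s - t := (le_div_iff₀ hη0).1 (Nat.floor_le hst)
  have hj2 : s - t < (j + 1) * η := (div_lt_iff₀ hη0).1 (Nat.lt_floor_add_one _)
  have hjN : j ≤ N := by
    have : (j : ℝ) * η ≤ N * η := by linarith [hs.2]
    exact_mod_cast le_of_mul_le_mul_right this hη0
  have hjI := hgrid j hjN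
  rw [← intervalIntegral.integral_add_adjacent_intervals (hint t htI _ hjI) (hint _ hjI _ hs)]
  have hlast : ‖∫ s in (t + j * η)..s, (F s (x s) (α s) - w s)‖ ≤ 2 * M * |s - (t + j * η)| := by
    refine intervalIntegral.norm_integral_le_of_norm_le_const fun τ hτ => ?_
    have hτI : τ ∈ Icc t T := ordConnected_Icc.uIcc_subset hjI hs (uIoc_subset_uIcc hτ)
    refine (norm_sub_le _ _).trans ?_
    linarith [hFM τ hτI _ (hmA τ), hwM τ hτI]
  rw [abs_of_nonneg (by linarith)] at hlast
  calc _ ≤ j * (2 * K * (1 + M) * η * η) + 2 * M * (s - (t + j * η)) :=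
        (norm_add_le _ _).trans (add_le_add (hind j hjN) hlast)
    _ ≤ N * (2 * K * (1 + M) * η * η) + 2 * M * η := by
        gcongr
        linarith
    _ = C * η := by rw [hC, ← hNη]; ring
    _ ≤ δ := hCη

end Chattering

/-! ### Relaxation and convergence of the values -/

section Relaxation

variable {n m : ℕ} {A : Set (EuclideanSpace ℝ (Fin m))}
  {f : ℝ → EuclideanSpace ℝ (Fin n) → EuclideanSpace ℝ (Fin m) → EuclideanSpace ℝ (Fin n)}
  {L : ℝ → EuclideanSpace ℝ (Fin n) → EuclideanSpace ℝ (Fin m) → ℝ}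
  {c : ℝ → EuclideanSpace ℝ (Fin n) → ℝ} {T K t : ℝ} {x₀ : EuclideanSpace ℝ (Fin n)}

/-- Relaxation: a feasible pair of the transformed problem is approximated, in trajectory and in
cost, by the trajectory of an ordinary control. -/
theorem IsLaxFeasible.exists_control {x β : ℝ → EuclideanSpace ℝ (Fin n)}
    (h : IsLaxFeasible A f c T t x₀ x β) (hF : IsLipField A T K (augField f L)) (hA : IsCompact A)
    (hA_ne : A.Nonempty) (hK : 0 < K) (ht : t ∈ Icc 0 T) {ρ : ℝ} (hρ : 0 < ρ) :
    ∃ y α, IsControl A t T α ∧ IsTrajectory t T x₀ y (fun s => f s (y s) (α s)) ∧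
      (∀ s ∈ Icc t T, ‖y s - x s‖ ≤ ρ) ∧
      ∫ s in t..T, L s (y s) (α s) ≤
        (∫ s in t..T, (hamiltonianConj A f L s (x s) (β s)).toReal) + ρ := by
  have htT := ht.2
  have hTt : 0 ≤ T - t := sub_nonneg.2 htT
  have hsub : Icc t T ⊆ Icc 0 T := Icc_subset_Icc_left ht.1
  have htI : t ∈ Icc t T := ⟨le_rfl, htT⟩
  have hTI : T ∈ Icc t T := ⟨htT, le_rfl⟩
  have hx := h.dynamics.continuousOn htT
  have hw := h.intervalIntegrable hF hA hA_ne hK ht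
  obtain ⟨M, hM, hFM, hwM⟩ := h.exists_bound hF hA hA_ne hK ht
  have hwt : ∀ s ∈ Icc t T, IntervalIntegrable
      (fun s => (-β s, (hamiltonianConj A f L s (x s) (β s)).toReal)) volume t s := fun s hs =>
    hw.mono_set (by rw [uIcc_of_le htT, uIcc_of_le hs.1]; exact Icc_subset_Icc_right hs.2)
  have hβt : ∀ s ∈ Icc t T, IntervalIntegrable (fun s => -β s) volume t s := fun s hs =>
    h.dynamics.1.mono_set (by rw [uIcc_of_le htT, uIcc_of_le hs.1]; exact Icc_subset_Icc_right hs.2)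
  have hxM : ∀ a ∈ Icc t T, ∀ b ∈ Icc t T, ‖x a - x b‖ ≤ M * |a - b| := by
    intro a ha b hb
    rw [h.dynamics.2 a ha, h.dynamics.2 b hb, add_sub_add_left_eq_sub,
      intervalIntegral.integral_interval_sub_left (hβt a ha) (hβt b hb)]
    refine intervalIntegral.norm_integral_le_of_norm_le_const fun τ hτ => ?_
    exact (norm_fst_le _).trans (hwM τ (ordConnected_Icc.uIcc_subset hb ha (uIoc_subset_uIcc hτ)))
  set C := 2 * Real.exp (2 * K * (T - t)) with hC
  have hC0 : 0 < C := by positivity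
  -- The denominator adds up the trajectory error C, the primitive error 1, and the cost K(T - t)C
  -- of replacing x by y in L; C itself is the Grönwall factor.
  set δ := ρ / (C + 1 + K * (T - t) * C) with hδdef
  have hden : 0 < C + 1 + K * (T - t) * C := by positivity
  have hδ : 0 < δ := by positivity
  have hδρ : C * δ + δ + K * (T - t) * C * δ = ρ := by rw [hδdef]; field_simp
  obtain ⟨α, hα, hαA, hαδ⟩ := exists_control_forall_norm_integral_sub_le hF hA hA_ne hK ht hM hx
    hxM hFM hw hwM (fun s hs => (h.mem_hull hF hA hA_ne ht hs).2) hδ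
  -- The control was built along the fixed curve x; y is the genuine trajectory it drives from x₀.
  obtain ⟨y, hy, hyeq⟩ := exists_eq_add_integral htT hK x₀ (fun τ z => f τ z (α τ))
    (fun z hz => hF.fst.intervalIntegrable hA hK ht hz.continuousOn hα hαA htI hTI)
    (fun τ hτ z z' => by
      simpa using hF.fst.lip (α τ) (hαA τ) τ (hsub hτ) τ (hsub hτ) z z')
  have hfy : ∀ s ∈ Icc t T, IntervalIntegrable (fun τ => f τ (y τ) (α τ)) volume t s := fun s hs =>
    hF.fst.intervalIntegrable hA hK ht hy.continuousOn hα hαA htI hs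
  have hfx : ∀ s ∈ Icc t T, IntervalIntegrable (fun τ => f τ (x τ) (α τ)) volume t s := fun s hs =>
    hF.fst.intervalIntegrable hA hK ht hx hα hαA htI hs
  have hFx : ∀ s ∈ Icc t T, IntervalIntegrable (fun τ => augField f L τ (x τ) (α τ) -
      (-β τ, (hamiltonianConj A f L τ (x τ) (β τ)).toReal)) volume t s := fun s hs =>
    (hF.intervalIntegrable hA hK ht hx hα hαA htI hs).sub (hwt s hs)
  have hdiff : ContinuousOn (fun s => ‖y s - x s‖) (Icc t T) := (hy.continuousOn.sub hx).norm
  have hnear : ∀ s ∈ Icc t T, ‖y s - x s‖ ≤ C * δ := by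
    intro s hs
    have := le_of_le_add_mul_integral hK hδ.le hdiff (fun s hs => ?_) s hs
    · rw [hC]; linarith
    have hsplit : y s - x s = (∫ τ in t..s, (f τ (x τ) (α τ) - -β τ)) +
        ∫ τ in t..s, (f τ (y τ) (α τ) - f τ (x τ) (α τ)) := by
      rw [hyeq s hs, h.dynamics.2 s hs, intervalIntegral.integral_sub (hfx s hs) (hβt s hs),
        intervalIntegral.integral_sub (hfy s hs) (hfx s hs)]
      abel
    have h1 : ‖∫ τ in t..s, (f τ (x τ) (α τ) - -β τ)‖ ≤ δ := by
      have h2 := fst_intervalIntegral (hFx s hs)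
      simp only [Prod.fst_sub, augField] at h2
      rw [← h2]
      exact (norm_fst_le _).trans (hαδ s hs)
    have h2 : ‖∫ τ in t..s, (f τ (y τ) (α τ) - f τ (x τ) (α τ))‖ ≤
        ∫ τ in t..s, K * ‖y τ - x τ‖ := by
      refine intervalIntegral.norm_integral_le_of_norm_le hs.1 (ae_of_all _ fun τ hτ => ?_) ?_
      · have hτI := hsub ⟨hτ.1.le, hτ.2.trans hs.2⟩
        simpa using hF.fst.lip (α τ) (hαA τ) τ hτI τ hτI (y τ) (x τ)
      · apply ContinuousOn.intervalIntegrable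
        rw [uIcc_of_le hs.1]
        exact (continuousOn_const.mul hdiff).mono (Icc_subset_Icc_right hs.2)
    rw [intervalIntegral.integral_const_mul] at h2
    rw [hsplit]
    exact (norm_add_le _ _).trans (add_le_add h1 h2)
  have hrest : 0 ≤ K * (T - t) * C * δ := by positivity
  obtain ⟨R, hR⟩ := hA.isBounded.exists_norm_le
  refine ⟨y, α, ⟨memLp_top_of_bound hα.aestronglyMeasurable R (ae_of_all _ fun s => hR _ (hαA s)),
    fun s _ => hαA s⟩, ⟨hfy T hTI, hyeq⟩, fun s hs => (hnear s hs).trans (by linarith), ?_⟩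
  have hLy : IntervalIntegrable (fun τ => L τ (y τ) (α τ)) volume t T :=
    hF.snd.intervalIntegrable hA hK ht hy.continuousOn hα hαA htI hTI
  have hLx : IntervalIntegrable (fun τ => L τ (x τ) (α τ)) volume t T :=
    hF.snd.intervalIntegrable hA hK ht hx hα hαA htI hTI
  have hH : IntervalIntegrable (fun s => (hamiltonianConj A f L s (x s) (β s)).toReal) volume t T :=
    (intervalIntegrable_iff_integrableOn_Icc_of_le htT).2
      ((intervalIntegrable_iff_integrableOn_Icc_of_le htT).1 hw).snd
  have h1 : ‖∫ s in t..T, (L s (y s) (α s) - L s (x s) (α s))‖ ≤ K * (C * δ) * |T - t| := by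
    refine intervalIntegral.norm_integral_le_of_norm_le_const fun s hs => ?_
    rw [uIoc_of_le htT] at hs
    have hsI := Ioc_subset_Icc_self hs
    have := hF.snd.lip (α s) (hαA s) s (hsub hsI) s (hsub hsI) (y s) (x s)
    rw [sub_self, abs_zero, zero_add] at this
    exact this.trans (by gcongr; exact hnear s hsI)
  have h2 : ‖∫ s in t..T, (L s (x s) (α s) - (hamiltonianConj A f L s (x s) (β s)).toReal)‖ ≤ δ := by
    have h3 := snd_intervalIntegral (hFx T hTI)
    simp only [Prod.snd_sub, augField] at h3
    rw [← h3]
    exact (norm_snd_le _).trans (hαδ T hTI)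
  rw [intervalIntegral.integral_sub hLy hLx, abs_of_nonneg hTt, Real.norm_eq_abs] at h1
  rw [intervalIntegral.integral_sub hLx hH, Real.norm_eq_abs] at h2
  have h3 : 0 ≤ C * δ := by positivity
  linarith [abs_le.1 h1, abs_le.1 h2]

/-- Relaxing the state constraint by any `ε > 0` makes the original value at most the transformed
one. -/
theorem valueEps_le_laxValue (hF : IsLipField A T K (augField f L)) (hA : IsCompact A)
    (hA_ne : A.Nonempty) (hK : 0 < K) {g : EuclideanSpace ℝ (Fin n) → ℝ} {Kg Kc : ℝ}
    (hg : ∀ x₁ x₂, |g x₁ - g x₂| ≤ Kg * ‖x₁ - x₂‖)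
    (hc : ∀ s ∈ Icc 0 T, ∀ x₁ x₂, |c s x₁ - c s x₂| ≤ Kc * ‖x₁ - x₂‖)
    (ht : t ∈ Icc 0 T) {ε : ℝ} (hε : 0 < ε) :
    valueEps A f L g c T ε t x₀ ≤ laxValue A f L g c T t x₀ := by
  refine le_sInf ?_
  rintro _ ⟨x, β, h, rfl⟩
  set J := (∫ s in t..T, (hamiltonianConj A f L s (x s) (β s)).toReal) + g (x T)
  have key : ∀ δ : ℝ, 0 < δ → valueEps A f L g c T ε t x₀ ≤ ((J + δ : ℝ) : EReal) := by
    intro δ hδ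
    -- The first bound keeps the change of c below ε, the second keeps the total change of cost
    -- below δ; adding one avoids zero denominators.
    set ρ := min (ε / (|Kc| + 1)) (δ / (|Kg| + 1)) with hρdef
    have hρ : 0 < ρ := lt_min (by positivity) (by positivity)
    have hρc : |Kc| * ρ ≤ ε := by
      have := (le_div_iff₀ (by positivity)).1 (min_le_left (ε / (|Kc| + 1)) (δ / (|Kg| + 1)))
      rw [← hρdef] at this
      linarith
    have hρg : ρ + |Kg| * ρ ≤ δ := by
      have := (le_div_iff₀ (by positivity)).1 (min_le_right (ε / (|Kc| + 1)) (δ / (|Kg| + 1)))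
      rw [← hρdef] at this
      linarith
    obtain ⟨y, α, hα, hy, hyx, hcost⟩ := h.exists_control hF hA hA_ne hK ht hρ
    have hlip : ∀ k : ℝ, ∀ s ∈ Icc t T, k * ‖y s - x s‖ ≤ |k| * ρ := fun k s hs =>
      mul_le_mul (le_abs_self k) (hyx s hs) (norm_nonneg _) (abs_nonneg k)
    have hfeas : IsFeasible A f c T ε t x₀ y α := ⟨hα, hy, fun s hs => by
      have h1 := hc s (Icc_subset_Icc_left ht.1 hs) (y s) (x s)
      linarith [abs_le.1 h1, h.state s hs, hlip Kc s hs]⟩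
    have hval : valueEps A f L g c T ε t x₀ ≤
        (((∫ s in t..T, L s (y s) (α s)) + g (y T) : ℝ) : EReal) := sInf_le ⟨y, α, hfeas, rfl⟩
    refine hval.trans (EReal.coe_le_coe_iff.2 ?_)
    have h1 := hg (y T) (x T)
    linarith [abs_le.1 h1, hlip Kg T ⟨ht.2, le_rfl⟩]
  have hlim : Tendsto (fun δ : ℝ => ((J + δ : ℝ) : EReal)) (𝓝[>] 0) (𝓝 (J : EReal)) := by
    have : Continuous fun δ : ℝ => ((J + δ : ℝ) : EReal) :=
      continuous_coe_real_ereal.comp (by fun_prop)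
    simpa using (this.tendsto 0).mono_left nhdsWithin_le_nhds
  exact ge_of_tendsto hlim (eventually_nhdsWithin_of_forall fun δ hδ => key δ hδ)

theorem valueEps_antitone {g : EuclideanSpace ℝ (Fin n) → ℝ} {ε ε' : ℝ} (hε : ε ≤ ε') :
    valueEps A f L g c T ε' t x₀ ≤ valueEps A f L g c T ε t x₀ := by
  refine sInf_le_sInf ?_
  rintro J ⟨x, α, h, hJ⟩
  exact ⟨x, α, ⟨h.control, h.dynamics, fun s hs => (h.state s hs).trans hε⟩, hJ⟩

theorem tendsto_valueEps (hF : IsLipField A T K (augField f L)) (hA : IsCompact A)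
    (hA_ne : A.Nonempty) (hK : 0 < K) {g : EuclideanSpace ℝ (Fin n) → ℝ} {Kg Kc : ℝ}
    (hg : ∀ x₁ x₂, |g x₁ - g x₂| ≤ Kg * ‖x₁ - x₂‖)
    (hc : ∀ s ∈ Icc 0 T, ∀ x₁ x₂, |c s x₁ - c s x₂| ≤ Kc * ‖x₁ - x₂‖) (ht : t ∈ Icc 0 T) :
    Tendsto (fun ε : ℝ => valueEps A f L g c T ε t x₀) (𝓝[>] 0)
      (𝓝 (laxValue A f L g c T t x₀)) := by
  have hcont : ∀ {k : ℝ} {φ : EuclideanSpace ℝ (Fin n) → ℝ},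
      (∀ x₁ x₂, |φ x₁ - φ x₂| ≤ k * ‖x₁ - x₂‖) → Continuous φ := fun {k φ} hφ =>
    (LipschitzWith.of_dist_le' fun x y => by
      rw [Real.dist_eq, dist_eq_norm]; exact hφ x y).continuous
  refine tendsto_order.2 ⟨fun a ha => ?_, fun a ha => ?_⟩
  · suffices hex : ∃ ε₀ > 0, a < valueEps A f L g c T ε₀ t x₀ by
      obtain ⟨ε₀, hε₀, hlt⟩ := hex
      filter_upwards [Ioo_mem_nhdsGT hε₀] with ε hε
      exact hlt.trans_le (valueEps_antitone hε.2.le)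
    by_contra! hcon
    obtain ⟨q, haq, hq⟩ := EReal.lt_iff_exists_real_btwn.1 ha
    refine hq.not_ge (laxValue_le_of_forall_exists hF hA hA_ne hK (hcont hg)
      (fun s hs => hcont (hc s hs)) ht fun ε hε => ?_)
    obtain ⟨_, ⟨x, α, h, rfl⟩, hlt⟩ := sInf_lt_iff.1 ((hcon ε hε).trans_lt haq)
    exact ⟨x, α, h, (EReal.coe_lt_coe_iff.1 hlt).le⟩
  · exact eventually_nhdsWithin_of_forall fun ε hε =>
      (valueEps_le_laxValue hF hA hA_ne hK hg hc ht hε).trans_lt ha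

end Relaxation

end StateConstrainedLax

theorem theorem4 {n m : ℕ} (T : ℝ)
    (A : Set (EuclideanSpace ℝ (Fin m)))
    (f : ℝ → EuclideanSpace ℝ (Fin n) → EuclideanSpace ℝ (Fin m) → EuclideanSpace ℝ (Fin n))
    (L : ℝ → EuclideanSpace ℝ (Fin n) → EuclideanSpace ℝ (Fin m) → ℝ)
    (g : EuclideanSpace ℝ (Fin n) → ℝ)
    (c : ℝ → EuclideanSpace ℝ (Fin n) → ℝ)
    (hA : IsCompact A) (hA_ne : A.Nonempty)
    -- `f` and `L` are continuous in the control
    (hf_cont : ∀ s ∈ Set.Icc 0 T, ∀ x, ContinuousOn (fun a => f s x a) A)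
    (hL_cont : ∀ s ∈ Set.Icc 0 T, ∀ x, ContinuousOn (fun a => L s x a) A)
    -- Lipschitz continuity in `(s, x)`, uniformly in the control
    (Kf KL Kg Kc : ℝ)
    (hf : ∀ a ∈ A, ∀ s₁ ∈ Set.Icc 0 T, ∀ s₂ ∈ Set.Icc 0 T, ∀ x₁ x₂,
      ‖f s₁ x₁ a - f s₂ x₂ a‖ ≤ Kf * (|s₁ - s₂| + ‖x₁ - x₂‖))
    (hL : ∀ a ∈ A, ∀ s₁ ∈ Set.Icc 0 T, ∀ s₂ ∈ Set.Icc 0 T, ∀ x₁ x₂,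
      |L s₁ x₁ a - L s₂ x₂ a| ≤ KL * (|s₁ - s₂| + ‖x₁ - x₂‖))
    (hg : ∀ x₁ x₂, |g x₁ - g x₂| ≤ Kg * ‖x₁ - x₂‖)
    (hc : ∀ s₁ ∈ Set.Icc 0 T, ∀ s₂ ∈ Set.Icc 0 T, ∀ x₁ x₂,
      |c s₁ x₁ - c s₂ x₂| ≤ Kc * (|s₁ - s₂| + ‖x₁ - x₂‖))
    -- `L` and `g` are bounded below
    (C : ℝ) (hL_below : ∀ s ∈ Set.Icc 0 T, ∀ x, ∀ a ∈ A, C ≤ L s x a) (hg_below : ∀ x, C ≤ g x)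
    (t : ℝ) (ht : t ∈ Set.Icc 0 T) (x₀ : EuclideanSpace ℝ (Fin n)) :
    -- the stage cost is integrable along every feasible pair of the original problems
    (∀ ε x α, StateConstrainedLax.IsFeasible A f c T ε t x₀ x α →
      IntervalIntegrable (fun s => L s (x s) (α s)) MeasureTheory.volume t T) ∧
    -- the stage cost `H^*` is finite and integrable along every feasible pair of the new problem
    (∀ x β, StateConstrainedLax.IsLaxFeasible A f c T t x₀ x β →
      (∀ s ∈ Set.Icc t T,
        StateConstrainedLax.hamiltonianConj A f L s (x s) (β s) ≠ ⊤ ∧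
        StateConstrainedLax.hamiltonianConj A f L s (x s) (β s) ≠ ⊥) ∧
      IntervalIntegrable
        (fun s => (StateConstrainedLax.hamiltonianConj A f L s (x s) (β s)).toReal)
        MeasureTheory.volume t T) ∧
    -- the limit `ϑ = lim ϑ^ε` as `ε → 0+` exists and equals the value of the new problem
    Filter.Tendsto (fun ε : ℝ => StateConstrainedLax.valueEps A f L g c T ε t x₀)
      (nhdsWithin 0 (Set.Ioi 0))
      (nhds (StateConstrainedLax.laxValue A f L g c T t x₀)) := by
  -- The product carries the sup norm, so the larger of the two constants serves for (f, L); adding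
  -- one makes it positive.
  have hF : StateConstrainedLax.IsLipField A T (max |Kf| |KL| + 1)
      (StateConstrainedLax.augField f L) := by
    refine ⟨fun s hs x => (hf_cont s hs x).prodMk (hL_cont s hs x),
      fun a ha s₁ h₁ s₂ h₂ x₁ x₂ => ?_⟩
    have h0 : 0 ≤ |s₁ - s₂| + ‖x₁ - x₂‖ := by positivity
    refine max_le ((hf a ha s₁ h₁ s₂ h₂ x₁ x₂).trans ?_) ((hL a ha s₁ h₁ s₂ h₂ x₁ x₂).trans ?_)
    · exact mul_le_mul_of_nonneg_right
        (by linarith [le_abs_self Kf, le_max_left |Kf| |KL|]) h0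
    · exact mul_le_mul_of_nonneg_right
        (by linarith [le_abs_self KL, le_max_right |Kf| |KL|]) h0
  have hK : 0 < max |Kf| |KL| + 1 := by positivity
  refine ⟨fun ε x α h => ?_, fun x β h => ⟨fun s hs => ?_, ?_⟩, ?_⟩
  · exact (intervalIntegrable_iff_integrableOn_Icc_of_le ht.2).2
      (h.integrableOn_augField hF hA hK ht).snd
  · rw [(h.mem_hull hF hA hA_ne ht hs).1]
    exact ⟨EReal.coe_ne_top _, EReal.coe_ne_bot _⟩
  · exact (intervalIntegrable_iff_integrableOn_Icc_of_le ht.2).2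
      ((intervalIntegrable_iff_integrableOn_Icc_of_le ht.2).1
        (h.intervalIntegrable hF hA hA_ne hK ht)).snd
  · exact StateConstrainedLax.tendsto_valueEps hF hA hA_ne hK hg
      (fun s hs x₁ x₂ => by simpa using hc s hs s hs x₁ x₂) ht
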